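/- **Setting.** Let $X$ be a complete separable metric space with Borel $\sigma$-algebra $\mathcal A$, let $\mu$ be a measure on $(X,\mathcal A)$ that is boundedly finite (finite on bounded Borel sets), has no atoms and satisfies $\mu(X)=\infty$, and let $T$ be an invertible bimeasurable transformation of $X$ preserving $\mu$. Measures on $X$ are measured by means of the evaluations $\xi\mapsto\xi(A)$, $A\in\mathcal A$. A *simple counting measure* is a measure $\sum_{x\in s}\delta_x$, where $s\subset X$ is at most countable and every bounded set contains only finitely many points of $s$. A *$T$-point process* is a random variable $N$ on a probability space $(\Omega,\mathcal F,\mathbb P)$, endowed with an invertible measure preserving transformation $S$, whose values are simple counting measures on $X$, such that for every $A\in\mathcal A$: $N(A)=0$ a.s. if $\mu(A)=0$, and $N(A)\circ S=N(T^{-1}A)$ a.s. It is *ergodic* if its law is ergodic for the push-forward map $T_*:\xi\mapsto T_*\xi$. It has *moments of all orders* if $\mathbb E[N(A)^n]<\infty$ for every bounded $A\in\mathcal A$ and every $n$; its *$n$-th moment measure* is the measure $M_n^N=\mathbb E[N\otimes\cdots\otimes N]$ on $X^n$, that is, $M^N_n(A_1\times\cdots\times A_n)=\mathbb E[N(A_1)\cdots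 N(A_n)]$. For a measure $\nu$ on $X$, $N$ is a *Poisson process of intensity $\nu$* if for any disjoint $A_1,\dots,A_k\in\mathcal A$ with $\nu(A_i)<\infty$ the variables $N(A_1),\dots,N(A_k)$ are independent and Poisson distributed with parameters $\nu(A_1),\dots,\nu(A_k)$ (a Poisson variable of parameter $0$ being $0$ a.s.). For a partition $\pi$ of $\{1,\dots,n\}$, the *partition measure* $m_\pi$ is the measure on $X^n$ given by $$m_\pi(A_1\times\cdots\times A_n)=\prod_{Q\in\pi}\mu\Bigl(\bigcap_{i\in Q}A_i\Bigr).$$ **Theorem.** Suppose that every $A\in\mathcal A$ with $T^{-1}A=A$ satisfies $\mu(A)=0$ or $\mu(A)=\infty$, and let $N$ be a $T$-point process with moments of all orders. Then there is a real number $a\ge 0$ such that $N$ is a Poisson process of intensity $a\mu$ if and only if $N$ is ergodic and, for every $n\ge1$, there are nonnegative real numbers $\alpha_\pi$, indexed by the partitions $\pi$ of $\{1,\dots,n\}$, such that $$M_n^N=\sum_{\pi}\alpha_\pi\,m_\pi .$$ -/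

import Mathlib

open MeasureTheory ProbabilityTheory
open scoped ENNReal NNReal

namespace TPoint

/-- A measure on a metric space is boundedly finite if every bounded Borel set has finite mass. -/
def IsBoundedlyFinite {X : Type*} [MetricSpace X] [MeasurableSpace X] (ξ : Measure X) : Prop :=
  ∀ B : Set X, MeasurableSet B → Bornology.IsBounded B → ξ B < ∞

/-- A simple counting measure: a sum of Dirac masses at the points of an at most countable set
of which every bounded set contains only finitely many points. -/
def IsSimpleCounting {X : Type*} [MetricSpace X] [MeasurableSpace X] (ξ : Measure X) : Prop :=
  ∃ s : Set X, s.Countable ∧ (∀ B : Set X, Bornology.IsBounded B → (s ∩ B).Finite) ∧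
    ξ = Measure.sum (fun x : s => Measure.dirac (x : X))

/-- A `T`-random measure `N`, defined on the probability space `(Ω, P)` with the invertible
measure preserving transformation `S`. It takes its values in the boundedly finite measures, and
is measurable for the σ-algebra generated by the evaluations `ξ ↦ ξ A` with `A` Borel (on the
boundedly finite measures of a complete separable metric space this is the Borel σ-algebra). -/
structure IsTRandomMeasure {X Ω : Type*} [MetricSpace X] [MeasurableSpace X] [MeasurableSpace Ω]
    (μ : Measure X) (T : X ≃ᵐ X) (P : Measure Ω) (S : Ω ≃ᵐ Ω) (N : Ω → Measure X) : Prop where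
  measurable : Measurable N
  boundedlyFinite : ∀ ω, IsBoundedlyFinite (N ω)
  null_of_null : ∀ A : Set X, MeasurableSet A → μ A = 0 → ∀ᵐ ω ∂P, N ω A = 0
  measurePreserving : MeasurePreserving S P P
  equivariant : ∀ A : Set X, MeasurableSet A → ∀ᵐ ω ∂P, N (S ω) A = N ω (T ⁻¹' A)

/-- A `T`-point process: a `T`-random measure whose values are simple counting measures. -/
structure IsTPointProcess {X Ω : Type*} [MetricSpace X] [MeasurableSpace X] [MeasurableSpace Ω]
    (μ : Measure X) (T : X ≃ᵐ X) (P : Measure Ω) (S : Ω ≃ᵐ Ω) (N : Ω → Measure X) : Prop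
    extends IsTRandomMeasure μ T P S N where
  simpleCounting : ∀ ω, IsSimpleCounting (N ω)

/-- Ergodicity of `N`: the law `m` of `N` is ergodic for the push-forward map `T_* : ξ ↦ T_* ξ`.
The law is seen as a measure on the space of all measures on `X`, where `T_*` is everywhere
defined; it is carried by the boundedly finite measures all of whose images under powers of `T_*`
are boundedly finite. -/
def IsErgodicProcess {X Ω : Type*} [MeasurableSpace X] [MeasurableSpace Ω]
    (T : X ≃ᵐ X) (P : Measure Ω) (N : Ω → Measure X) : Prop :=
  Ergodic (fun ξ : Measure X => ξ.map T) (P.map N)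

/-- `N` has moments of order `n`: `E[N(A)ⁿ] < ∞` for every bounded Borel set `A`. -/
def HasMoments {X Ω : Type*} [MetricSpace X] [MeasurableSpace X] [MeasurableSpace Ω]
    (P : Measure Ω) (N : Ω → Measure X) (n : ℕ) : Prop :=
  ∀ A : Set X, MeasurableSet A → Bornology.IsBounded A → ∫⁻ ω, (N ω A) ^ n ∂P < ∞

/-- The `n`-th order moment measure `E[N ⊗ ⋯ ⊗ N]` on `Xⁿ`. See `momentMeasure_pi` for its
values on product sets. -/
noncomputable def momentMeasure {X Ω : Type*} [MeasurableSpace X] [MeasurableSpace Ω]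
    (P : Measure Ω) (N : Ω → Measure X) (n : ℕ) : Measure (Fin n → X) :=
  P.bind (fun ω => Measure.pi (fun _ : Fin n => N ω))

/-- The partition measure `m_π` on `Xⁿ`: the image of the product of copies of `μ` indexed by the
atoms of `π` under the map which sends a family `(y_Q)` of points indexed by the atoms to the
`n`-tuple whose `i`-th coordinate is `y_Q`, with `Q` the atom that contains `i`.
See `partitionMeasure_pi` for its values on product sets. -/
noncomputable def partitionMeasure {X : Type*} [MeasurableSpace X] (μ : Measure X) {n : ℕ}
    (π : Finpartition (Finset.univ : Finset (Fin n))) : Measure (Fin n → X) :=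
  (Measure.pi (fun _ : π.parts => μ)).map
    (fun y i => y ⟨π.part i, π.part_mem.2 (Finset.mem_univ i)⟩)

/-- `N` is a Poisson point process of intensity `ν`: a random simple counting measure whose values
on finitely many disjoint Borel sets of finite `ν`-measure are independent and Poisson distributed,
the parameters being the `ν`-measures of the sets (a Poisson variable of parameter `0` is `0`). -/
structure IsPoissonProcess {X Ω : Type*} [MetricSpace X] [MeasurableSpace X] [MeasurableSpace Ω]
    (ν : Measure X) (P : Measure Ω) (N : Ω → Measure X) : Prop where
  measurable : Measurable N
  simpleCounting : ∀ ω, IsSimpleCounting (N ω)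
  indep : ∀ (k : ℕ) (A : Fin k → Set X), (∀ i, MeasurableSet (A i)) → (∀ i, ν (A i) < ∞) →
    Pairwise (fun i j => Disjoint (A i) (A j)) →
    iIndepFun (fun i ω => N ω (A i)) P
  law : ∀ A : Set X, MeasurableSet A → ν A < ∞ →
    P.map (fun ω => N ω A) = (poissonMeasure (ν A).toNNReal).map (fun j : ℕ => (j : ℝ≥0∞))

theorem IsBoundedlyFinite.sigmaFinite {X : Type*} [MetricSpace X] [MeasurableSpace X]
    [BorelSpace X] {ξ : Measure X} (h : IsBoundedlyFinite ξ) : SigmaFinite ξ := by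
  rcases isEmpty_or_nonempty X with hX | ⟨⟨x⟩⟩
  · rw [Measure.eq_zero_of_isEmpty ξ]; infer_instance
  · exact ⟨⟨⟨fun k => Metric.ball x k, fun _ => trivial,
      fun k => h _ measurableSet_ball Metric.isBounded_ball, Metric.iUnion_ball_nat x⟩⟩⟩

theorem partitionMeasure_pi {X : Type*} [MeasurableSpace X] (μ : Measure X) [SigmaFinite μ]
    {n : ℕ} (π : Finpartition (Finset.univ : Finset (Fin n))) (A : Fin n → Set X)
    (hA : ∀ i, MeasurableSet (A i)) :
    partitionMeasure μ π (Set.univ.pi A) = ∏ Q ∈ π.parts, μ (⋂ i ∈ Q, A i) := by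
  rw [partitionMeasure, Measure.map_apply (by fun_prop) (MeasurableSet.univ_pi hA)]
  have : (fun (y : π.parts → X) i => y ⟨π.part i, π.part_mem.2 (Finset.mem_univ i)⟩) ⁻¹'
      (Set.univ.pi A) = Set.univ.pi (fun Q : π.parts => ⋂ i ∈ Q.1, A i) := by
    ext y
    simp only [Set.mem_preimage, Set.mem_pi, Set.mem_univ, true_implies, Set.mem_iInter]
    constructor
    · rintro h ⟨Q, hQ⟩ i hi
      have := h i
      simp only [π.part_eq_of_mem hQ hi] at this
      exact this
    · intro h i
      exact h ⟨π.part i, π.part_mem.2 (Finset.mem_univ i)⟩ i (π.mem_part (Finset.mem_univ i))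
  rw [this, Measure.pi_pi]
  exact Finset.prod_coe_sort π.parts (fun Q => μ (⋂ i ∈ Q, A i))

theorem measurable_pi_of_boundedlyFinite {X Ω : Type*} [MetricSpace X] [MeasurableSpace X]
    [BorelSpace X] [MeasurableSpace Ω] {N : Ω → Measure X} (hN : Measurable N)
    (hb : ∀ ω, IsBoundedlyFinite (N ω)) (n : ℕ) :
    Measurable (fun ω => Measure.pi (fun _ : Fin n => N ω)) := by
  have hsf : ∀ ω, SigmaFinite (N ω) := fun ω => (hb ω).sigmaFinite
  rcases isEmpty_or_nonempty X with hX | ⟨⟨x⟩⟩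
  · have : N = fun _ => 0 := funext fun ω => Measure.eq_zero_of_isEmpty _
    rw [this]; exact measurable_const
  have key : ∀ k : ℕ, Measurable
      (fun ω => Measure.pi (fun _ : Fin n => (N ω).restrict (Metric.ball x k))) := by
    intro k
    have hfin : ∀ ω, IsFiniteMeasure ((N ω).restrict (Metric.ball x k)) := fun ω =>
      isFiniteMeasure_restrict.2 (hb ω _ measurableSet_ball Metric.isBounded_ball).ne
    refine Measurable.measure_of_isPiSystem generateFrom_pi.symm isPiSystem_pi ?_ ?_
    · rintro _ ⟨A, hA, rfl⟩
      simp only [Measure.pi_pi]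
      refine Finset.measurable_prod _ fun i _ => ?_
      have hAi : MeasurableSet (A i) := hA i (Set.mem_univ i)
      simp only [Measure.restrict_apply hAi]
      exact (Measure.measurable_coe (hAi.inter measurableSet_ball)).comp hN
    · have hu : (Set.univ : Set (Fin n → X)) = Set.univ.pi (fun _ => Set.univ) := by simp
      simp only [hu, Measure.pi_pi]
      refine Finset.measurable_prod _ fun i _ => ?_
      simp only [Measure.restrict_apply MeasurableSet.univ]
      exact (Measure.measurable_coe (MeasurableSet.univ.inter measurableSet_ball)).comp hN
  refine Measure.measurable_of_measurable_coe _ fun s hs => ?_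
  have hmono : Monotone (fun k : ℕ => s ∩ Set.univ.pi (fun _ : Fin n => Metric.ball x (k : ℝ))) :=
    fun a b hab => Set.inter_subset_inter_right _
      (Set.pi_mono fun i _ => Metric.ball_subset_ball (by exact_mod_cast hab))
  have hun : s = ⋃ k : ℕ, s ∩ Set.univ.pi (fun _ : Fin n => Metric.ball x (k : ℝ)) := by
    rw [← Set.inter_iUnion]
    refine (Set.inter_eq_left.2 fun y _ => ?_).symm
    obtain ⟨k, hk⟩ := exists_nat_gt (∑ i, dist (y i) x)
    refine Set.mem_iUnion.2 ⟨k, fun i _ => Metric.mem_ball.2 (lt_of_le_of_lt ?_ hk)⟩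
    exact Finset.single_le_sum (f := fun i => dist (y i) x) (fun _ _ => dist_nonneg)
      (Finset.mem_univ i)
  have : (fun ω => Measure.pi (fun _ : Fin n => N ω) s) = fun ω => ⨆ k : ℕ,
      Measure.pi (fun _ : Fin n => (N ω).restrict (Metric.ball x k)) s := by
    funext ω
    conv_lhs => rw [hun]
    rw [hmono.measure_iUnion]
    refine iSup_congr fun k => ?_
    rw [← Measure.restrict_pi_pi, Measure.restrict_apply hs]
  rw [this]
  exact Measurable.iSup fun k => (Measure.measurable_coe hs).comp (key k)

theorem momentMeasure_pi {X Ω : Type*} [MetricSpace X] [MeasurableSpace X]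
    [BorelSpace X] [MeasurableSpace Ω] (P : Measure Ω) {N : Ω → Measure X} (hN : Measurable N)
    (hb : ∀ ω, IsBoundedlyFinite (N ω)) {n : ℕ} (A : Fin n → Set X)
    (hA : ∀ i, MeasurableSet (A i)) :
    momentMeasure P N n (Set.univ.pi A) = ∫⁻ ω, ∏ i, N ω (A i) ∂P := by
  have hsf : ∀ ω, SigmaFinite (N ω) := fun ω => (hb ω).sigmaFinite
  rw [momentMeasure, Measure.bind_apply (MeasurableSet.univ_pi hA)
    (measurable_pi_of_boundedlyFinite hN hb n).aemeasurable]
  simp only [Measure.pi_pi]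

end TPoint

namespace TPoint

open Filter Topology

/-! Split `Xⁿ` according to which coordinates coincide. Where they coincide exactly along `π`, the
`n`-th power of a simple counting measure is a copy of its power of order `|π|` restricted to tuples
of distinct points, since repeating coordinates is injective and injections preserve counting
(`IsSimpleCounting.pi_inter_kernelTuples`). A Poisson process of intensity `ν` has off-diagonal
moment measures `νⁿ`, and these characterise it.

From Poisson to partitions: independence gives `νⁿ` on boxes with disjoint sides, and such boxes
determine a measure off the diagonals; hence `α_π = a ^ |π|`. For ergodicity, the mean ergodic
theorem in `L²(μ)` and the absence of invariant sets of positive finite measure make the Cesàro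
means of `μ (A ∩ T⁻ᵏ A)` tend to `0`. Some iterate therefore moves a given ball almost off itself.
An invariant event is nearly an event seen in a ball, so it is nearly independent of itself and has
probability `0` or `1`.

Conversely, `m_π` with `π ≠ ⊥` lives on the diagonals, while `μⁿ` does not charge them because `μ`
has no atoms; so the off-diagonal part of the `n`-th moment measure is `c_n μⁿ` with `c_n = α_⊥`.
Let `F` count the `n`-tuples of distinct points of `N` in `A`, and average `E[F · N(T⁻ᵏ A)]` over
`k`. Ergodicity gives the limit `c_n μ(A)ⁿ · c_1 μ(A)`. The partition form gives `c_{n+1} μ(A)ⁿ⁺¹`,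
up to an error at most `K μ (A ∩ T⁻ᵏ A)` that averages to `0`. Hence `c_{n+1} = c_1 c_n`
(`offDiagonal_coefficient_succ`) and `c_n = aⁿ`. Expanding `∏ (1 + z_j) ^ N(A_j)` in factorial
moments then yields the Poisson characteristic functions
(`integral_exp_eq_of_restrict_momentMeasure`). -/

/-! ### Mean ergodic theorems -/

/-- Von Neumann's theorem for the Koopman isometry, tested against `h`; `φ` is the orthogonal
projection of `g` onto the fixed vectors. The measure may be infinite, so this serves both for `μ`
and for the law of `N`. -/
theorem exists_invariant_tendsto_cesaro_integral_mul {α : Type*} [MeasurableSpace α]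
    {ρ : Measure α} {f : α → α} (hf : MeasurePreserving f ρ ρ) {g : α → ℝ} (hg : MemLp g 2 ρ) :
    ∃ φ : α → ℝ, MemLp φ 2 ρ ∧ φ ∘ f =ᵐ[ρ] φ ∧ ∀ h : α → ℝ, MemLp h 2 ρ →
      Tendsto (fun L : ℕ => (L : ℝ)⁻¹ * ∑ k ∈ Finset.range L, ∫ x, h x * g (f^[k] x) ∂ρ)
        atTop (𝓝 (∫ x, h x * φ x ∂ρ)) := by
  let U : Lp ℝ 2 ρ →ₗᵢ[ℝ] Lp ℝ 2 ρ := Lp.compMeasurePreservingₗᵢ ℝ f hf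
  let V : Lp ℝ 2 ρ →L[ℝ] Lp ℝ 2 ρ := U.toContinuousLinearMap
  have key := V.tendsto_birkhoffAverage_orthogonalProjection U.norm_toContinuousLinearMap_le
    (hg.toLp g)
  set p := (V.eqLocus (1 : Lp ℝ 2 ρ →L[ℝ] Lp ℝ 2 ρ)).orthogonalProjectionOnto (hg.toLp g) with hp
  have hfix : V (p : Lp ℝ 2 ρ) = p := p.2
  refine ⟨(p : Lp ℝ 2 ρ), Lp.memLp _, ?_, fun h hh => ?_⟩
  · have h1 := Lp.coeFn_compMeasurePreserving (p : Lp ℝ 2 ρ) hf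
    have h2 : Lp.compMeasurePreserving f hf (p : Lp ℝ 2 ρ) = p := hfix
    rw [h2] at h1
    exact h1.symm
  · have h1 : Tendsto (fun L : ℕ => inner ℝ (hh.toLp h)
        (birkhoffAverage ℝ V _root_.id L (hg.toLp g))) atTop
        (𝓝 (inner ℝ (hh.toLp h) (p : Lp ℝ 2 ρ))) :=
      (continuous_const.inner continuous_id).continuousAt.tendsto.comp key
    have hiter : ∀ k : ℕ, (V^[k]) (hg.toLp g) = (hg.comp_measurePreserving (hf.iterate k)).toLp _ := by
      intro k
      have : ⇑V = Lp.compMeasurePreserving f hf := rfl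
      rw [this, Lp.compMeasurePreserving_iterate, Lp.toLp_compMeasurePreserving]
    have hin : ∀ k : ℕ, inner ℝ (hh.toLp h) ((V^[k]) (hg.toLp g))
        = ∫ x, h x * g (f^[k] x) ∂ρ := by
      intro k
      rw [hiter k, L2.inner_def]
      refine integral_congr_ae ?_
      filter_upwards [hh.coeFn_toLp, (hg.comp_measurePreserving (hf.iterate k)).coeFn_toLp]
        with x hx hx'
      rw [hx, hx']
      simp [mul_comm]
    convert h1 using 1
    · funext L
      simp only [birkhoffAverage, birkhoffSum, inner_smul_right, inner_sum, id, hin]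
    · rw [L2.inner_def]
      congr 1
      refine integral_congr_ae ?_
      filter_upwards [hh.coeFn_toLp] with x hx
      rw [hx]
      simp [mul_comm]

/-- The invariant limit is a constant by ergodicity, and testing against `h = 1` identifies it as
the mean of `g`. -/
theorem tendsto_cesaro_integral_mul_of_ergodic {α : Type*} [MeasurableSpace α]
    {ρ : Measure α} [IsProbabilityMeasure ρ] {f : α → α} (hf : Ergodic f ρ) {g h : α → ℝ}
    (hg : MemLp g 2 ρ) (hh : MemLp h 2 ρ) :
    Tendsto (fun L : ℕ => (L : ℝ)⁻¹ * ∑ k ∈ Finset.range L, ∫ x, h x * g (f^[k] x) ∂ρ)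
      atTop (𝓝 ((∫ x, h x ∂ρ) * ∫ x, g x ∂ρ)) := by
  obtain ⟨φ, hφ, hinv, hlim⟩ :=
    exists_invariant_tendsto_cesaro_integral_mul hf.toMeasurePreserving hg
  obtain ⟨c, hc⟩ := hf.ae_eq_const_of_ae_eq_comp_ae hφ.1 hinv
  have hint : ∀ u : α → ℝ, ∫ x, u x * φ x ∂ρ = (∫ x, u x ∂ρ) * c := by
    intro u
    rw [← integral_mul_const]
    refine integral_congr_ae ?_
    filter_upwards [hc] with x hx
    rw [hx]; rfl
  have h1 := hlim (fun _ => 1) (memLp_const 1)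
  have hcg : c = ∫ x, g x ∂ρ := by
    rw [hint] at h1
    simp only [one_mul, integral_const, probReal_univ, smul_eq_mul] at h1
    have hk : ∀ k, ∫ x, g (f^[k] x) ∂ρ = ∫ x, g x ∂ρ := by
      intro k
      have hm := hf.toMeasurePreserving.iterate k
      conv_rhs => rw [← hm.map_eq]
      rw [integral_map hm.measurable.aemeasurable]
      rw [hm.map_eq]; exact hg.1
    simp only [hk, Finset.sum_const, Finset.card_range, nsmul_eq_mul] at h1
    refine tendsto_nhds_unique h1 (tendsto_const_nhds.congr' ?_)
    filter_upwards [eventually_gt_atTop 0] with L hL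
    have : (L : ℝ) ≠ 0 := by positivity
    field_simp
  have h2 := hlim h hh
  rwa [hint, hcg] at h2

/-- The invariant limit `φ` is in `L²(μ)`, so by Chebyshev the sets where `‖φ‖` is bounded below
have finite measure; being invariant they are null, and `φ = 0`. -/
theorem tendsto_cesaro_measureReal_inter {α : Type*} [MeasurableSpace α]
    {μ : Measure α} {T : α → α} (hT : MeasurePreserving T μ μ)
    (hinv : ∀ A : Set α, MeasurableSet A → T ⁻¹' A = A → μ A = 0 ∨ μ A = ∞)
    {A B : Set α} (hA : MeasurableSet A) (hB : MeasurableSet B) (hAf : μ A ≠ ∞) (hBf : μ B ≠ ∞) :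
    Tendsto (fun L : ℕ => (L : ℝ)⁻¹ * ∑ k ∈ Finset.range L, μ.real (A ∩ T^[k] ⁻¹' B))
      atTop (𝓝 0) := by
  have hind : ∀ {C : Set α}, MeasurableSet C → μ C ≠ ∞ →
      MemLp (C.indicator fun _ => (1 : ℝ)) 2 μ := fun hC h =>
    memLp_indicator_const 2 hC 1 (Or.inr h)
  obtain ⟨φ, hφ, hφinv, hlim⟩ := exists_invariant_tendsto_cesaro_integral_mul hT (hind hB hBf)
  have hz : φ =ᵐ[μ] 0 := by
    have hlev : ∀ n : ℕ, μ {x | (1 / ((n : ℝ) + 1)) ≤ ‖φ x‖} = 0 := by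
      intro n
      set E := {x | (1 / ((n : ℝ) + 1)) ≤ ‖φ x‖} with hE
      have hpos : (0 : ℝ) < 1 / ((n : ℝ) + 1) := by positivity
      have hfin : μ E ≠ ∞ := by
        have := hφ.meas_ge_lt_top (p := 2) (by norm_num) (by norm_num)
          (ε := (1 / ((n : ℝ≥0) + 1))) (by positivity)
        refine ne_of_lt (lt_of_le_of_lt (measure_mono ?_) this)
        intro x hx
        simp only [hE, Set.mem_ofPred_eq] at hx ⊢
        exact_mod_cast hx
      have hnm : NullMeasurableSet E μ :=
        nullMeasurableSet_le aemeasurable_const hφ.1.norm.aemeasurable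
      have hpre : T ⁻¹' E =ᵐ[μ] E := by
        refine (hφinv.mono fun x hx => ?_).set_eq
        have : φ (T x) = φ x := hx
        simp [hE, this]
      -- The level set is invariant only almost everywhere, whereas `hinv` concerns strictly
      -- invariant Borel sets.
      obtain ⟨F, hF, hFE, hFi⟩ :=
        hT.quasiMeasurePreserving.exists_preimage_eq_of_preimage_ae hnm hpre
      rcases hinv F hF hFi with h | h
      · rwa [measure_congr hFE] at h
      · rw [measure_congr hFE] at h; exact absurd h hfin
    have : ∀ᵐ x ∂μ, ∀ n : ℕ, ¬ (1 / ((n : ℝ) + 1)) ≤ ‖φ x‖ :=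
      ae_all_iff.2 fun n => by
        rw [ae_iff]; simpa using hlev n
    filter_upwards [this] with x hx
    by_contra hne
    obtain ⟨n, hn⟩ := exists_nat_one_div_lt (norm_pos_iff.2 hne)
    exact hx n hn.le
  have h1 := hlim _ (hind hA hAf)
  have h0 : ∫ x, A.indicator (fun _ => (1 : ℝ)) x * φ x ∂μ = 0 := by
    rw [integral_eq_zero_of_ae]
    filter_upwards [hz] with x hx
    simp [hx]
  rw [h0] at h1
  refine h1.congr fun L => ?_
  congr 1
  refine Finset.sum_congr rfl fun k _ => ?_
  have hk : MeasurableSet (T^[k] ⁻¹' B) := (hT.measurable.iterate k) hB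
  rw [← integral_indicator_one (hA.inter hk)]
  refine integral_congr_ae (Eventually.of_forall fun x => ?_)
  by_cases h1 : x ∈ A <;> by_cases h2 : T^[k] x ∈ B <;> simp [Set.indicator, h1, h2]

theorem exists_measure_inter_preimage_iterate_lt {α : Type*} [MeasurableSpace α]
    {μ : Measure α} {T : α → α} (hT : MeasurePreserving T μ μ)
    (hinv : ∀ A : Set α, MeasurableSet A → T ⁻¹' A = A → μ A = 0 ∨ μ A = ∞)
    {A : Set α} (hA : MeasurableSet A) (hAf : μ A ≠ ∞) {ε : ℝ≥0∞} (hε : ε ≠ 0) :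
    ∃ k : ℕ, μ (A ∩ T^[k] ⁻¹' A) < ε := by
  by_contra! hcon
  have hlim := tendsto_cesaro_measureReal_inter hT hinv hA hA hAf hAf
  have hfin : ∀ k, μ (A ∩ T^[k] ⁻¹' A) ≠ ∞ := fun k =>
    ne_top_of_le_ne_top hAf (measure_mono Set.inter_subset_left)
  have hεf : ε ≠ ∞ := ne_top_of_le_ne_top (hfin 0) (hcon 0)
  have hεpos : 0 < ε.toReal := ENNReal.toReal_pos hε hεf
  refine absurd (ge_of_tendsto hlim (b := ε.toReal) ?_) (not_le.2 hεpos)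
  filter_upwards [eventually_gt_atTop 0] with L hL
  have hL' : (0 : ℝ) < L := by exact_mod_cast hL
  rw [inv_mul_eq_div, le_div_iff₀ hL']
  calc ε.toReal * L = ∑ k ∈ Finset.range L, ε.toReal := by simp [mul_comm]
    _ ≤ _ := Finset.sum_le_sum fun k _ => ENNReal.toReal_mono (hfin k) (hcon k)

/-! ### Powers of counting measures and the diagonals of `Xⁿ` -/

/-- The tuples with pairwise distinct coordinates. -/
def injectiveTuples (ι X : Type*) : Set (ι → X) := {x | Function.Injective x}

theorem measurableSet_injectiveTuples {ι X : Type*} [Countable ι] [MeasurableSpace X]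
    [MeasurableEq X] : MeasurableSet (injectiveTuples ι X) := by
  have : injectiveTuples ι X = ⋂ (i : ι) (j : ι) (_ : i ≠ j), {x : ι → X | x i = x j}ᶜ := by
    ext x
    simp only [injectiveTuples, Function.Injective, Set.mem_ofPred_eq, Set.mem_iInter,
      Set.mem_compl_iff]
    exact forall₂_congr fun i j => not_imp_not.symm
  rw [this]
  exact .iInter fun i => .iInter fun j => .iInter fun _ =>
    (measurableSet_eq_fun (measurable_pi_apply i) (measurable_pi_apply j)).compl

theorem IsSimpleCounting.exists_eq_count_restrict {X : Type*} [MetricSpace X] [MeasurableSpace X]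
    [BorelSpace X] {ξ : Measure X} (h : IsSimpleCounting ξ) :
    ∃ s : Set X, s.Countable ∧ (∀ B : Set X, Bornology.IsBounded B → (s ∩ B).Finite) ∧
      ξ = Measure.count.restrict s := by
  obtain ⟨s, hs, hfin, rfl⟩ := h
  refine ⟨s, hs, hfin, Measure.ext fun A hA => ?_⟩
  rw [Measure.restrict_apply hA, Measure.count_apply (hA.inter hs.measurableSet),
    Measure.sum_apply _ hA]
  simp only [Measure.dirac_apply' _ hA]
  rw [tsum_subtype s (fun x => A.indicator (1 : X → ℝ≥0∞) x), Set.indicator_indicator,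
    Set.inter_comm, ← tsum_subtype]
  simp

theorem IsSimpleCounting.isBoundedlyFinite {X : Type*} [MetricSpace X] [MeasurableSpace X]
    [BorelSpace X] {ξ : Measure X} (h : IsSimpleCounting ξ) : IsBoundedlyFinite ξ := by
  obtain ⟨s, hs, hfin, rfl⟩ := h.exists_eq_count_restrict
  intro B hB hBb
  rw [Measure.restrict_apply hB, Set.inter_comm, Measure.count_apply_lt_top']
  · exact hfin B hBb
  · exact hs.measurableSet.inter hB

theorem measure_eq_of_countable_of_singleton {α : Type*} [MeasurableSpace α]
    [MeasurableSingletonClass α] {ρ₁ ρ₂ : Measure α} {S : Set α} (hS : S.Countable)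
    (h₁ : ρ₁ Sᶜ = 0) (h₂ : ρ₂ Sᶜ = 0) (h : ∀ x ∈ S, ρ₁ {x} = ρ₂ {x}) : ρ₁ = ρ₂ := by
  have key : ∀ ρ : Measure α, ρ Sᶜ = 0 → ∀ E, ρ E = ∑' x : ↥(E ∩ S), ρ {x.1} := by
    intro ρ hρ E
    rw [← measure_inter_conull hρ, ← measure_biUnion (hS.mono Set.inter_subset_right)
      (fun a _ b _ hab => by simpa using hab) (fun x _ => measurableSet_singleton x),
      Set.biUnion_of_singleton]
  refine Measure.ext fun E _ => ?_
  rw [key _ h₁, key _ h₂]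
  exact tsum_congr fun x => h x x.2.2

/-- Both measures are carried by the countable set `s^ι` and give mass one to each of its points. -/
theorem pi_count_restrict {ι X : Type*} [Fintype ι] [MeasurableSpace X]
    [MeasurableSingletonClass X] {s : Set X} (hs : s.Countable)
    [SigmaFinite ((Measure.count : Measure X).restrict s)] :
    Measure.pi (fun _ : ι => (Measure.count : Measure X).restrict s)
      = Measure.count.restrict (Set.univ.pi fun _ => s) := by
  have hS : (Set.univ.pi fun _ : ι => s).Countable := Set.countable_univ_pi fun _ => hs
  refine measure_eq_of_countable_of_singleton hS ?_ ?_ ?_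
  · have : ∀ᵐ x ∂(Measure.pi fun _ : ι => (Measure.count : Measure X).restrict s),
        ∀ i, x i ∈ s := eventually_all.2 fun i =>
      Measure.tendsto_eval_ae_ae.eventually (ae_restrict_mem hs.measurableSet)
    refine measure_mono_null (fun x hx => ?_) this
    simpa [Set.mem_pi] using hx
  · rw [Measure.restrict_apply hS.measurableSet.compl]; simp
  · intro x hx
    rw [Measure.pi_singleton, Measure.restrict_apply (measurableSet_singleton x)]
    have h1 : ∀ i, (Measure.count.restrict s) {x i} = 1 := fun i => by
      rw [Measure.restrict_apply (measurableSet_singleton _),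
        Set.inter_eq_left.2 (Set.singleton_subset_iff.2 (hx i trivial)), Measure.count_singleton]
    rw [Set.inter_eq_left.2 (Set.singleton_subset_iff.2 hx), Measure.count_singleton]
    simp [h1]

theorem measurable_measure_pi {ι X Ω : Type*} [Fintype ι] [MetricSpace X] [MeasurableSpace X]
    [BorelSpace X] [MeasurableSpace Ω] {N : Ω → Measure X} (hN : Measurable N)
    (hb : ∀ ω, IsBoundedlyFinite (N ω)) :
    Measurable (fun ω => Measure.pi (fun _ : ι => N ω)) := by
  have hsf : ∀ ω, SigmaFinite (N ω) := fun ω => (hb ω).sigmaFinite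
  let e : Fin (Fintype.card ι) ≃ ι := (Fintype.equivFin ι).symm
  have : (fun ω => Measure.pi (fun _ : ι => N ω)) = fun ω =>
      (Measure.pi (fun _ : Fin (Fintype.card ι) => N ω)).map
        (MeasurableEquiv.piCongrLeft (fun _ : ι => X) e) := by
    funext ω
    exact (measurePreserving_piCongrLeft (fun _ : ι => N ω) e).map_eq.symm
  rw [this]
  exact (Measure.measurable_map _ (MeasurableEquiv.measurable _)).comp
    (measurable_pi_of_boundedlyFinite hN hb _)

theorem IsSimpleCounting.exists_pi_apply_eq_count {X : Type*} [MetricSpace X] [MeasurableSpace X]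
    [BorelSpace X] {ξ : Measure X} (h : IsSimpleCounting ξ) :
    ∃ s : Set X, s.Countable ∧ ξ = Measure.count.restrict s ∧
      ∀ (ι : Type) [Fintype ι] (E : Set (ι → X)), MeasurableSet E →
        Measure.pi (fun _ : ι => ξ) E = Measure.count (E ∩ Set.univ.pi fun _ => s) := by
  have hsf : SigmaFinite ξ := h.isBoundedlyFinite.sigmaFinite
  obtain ⟨s, hs, -, rfl⟩ := h.exists_eq_count_restrict
  refine ⟨s, hs, rfl, fun ι _ E hE => ?_⟩
  rw [pi_count_restrict hs, Measure.restrict_apply hE]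

/-- Fubini: once the `j`-th coordinate is fixed, the diagonal `x i = x j` becomes a hyperplane in
the others, which is null as `ν` has no atoms. -/
theorem pi_injectiveTuples_compl {ι X : Type*} [Fintype ι] [MeasurableSpace X] [MeasurableEq X]
    (ν : Measure X) [SigmaFinite ν] [NullSingletonClass ν] :
    Measure.pi (fun _ : ι => ν) (injectiveTuples ι X)ᶜ = 0 := by
  classical
  have hsub : (injectiveTuples ι X)ᶜ ⊆ ⋃ (i : ι) (j : ι) (_ : i ≠ j), {x : ι → X | x i = x j} := by
    intro x hx
    simp only [injectiveTuples, Function.Injective, Set.mem_compl_iff, Set.mem_ofPred_eq,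
      not_forall] at hx
    obtain ⟨i, j, h, hij⟩ := hx
    exact Set.mem_iUnion.2 ⟨i, Set.mem_iUnion.2 ⟨j, Set.mem_iUnion.2 ⟨hij, h⟩⟩⟩
  refine measure_mono_null hsub ?_
  refine measure_iUnion_null fun i => measure_iUnion_null fun j => measure_iUnion_null fun hij => ?_
  have hmp := measurePreserving_piEquivPiSubtypeProd (fun _ : ι => ν) (fun k => k = j)
  set Q : Set (({k // k = j} → X) × ({k // ¬ k = j} → X)) :=
    {p | p.2 ⟨i, hij⟩ = p.1 ⟨j, rfl⟩} with hQ
  have hQm : MeasurableSet Q := measurableSet_eq_fun (by fun_prop) (by fun_prop)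
  have hpre : {x : ι → X | x i = x j}
      = (MeasurableEquiv.piEquivPiSubtypeProd (fun _ : ι => X) (fun k => k = j)) ⁻¹' Q := rfl
  rw [hpre, hmp.measure_preimage hQm.nullMeasurableSet, Measure.measure_prod_null hQm]
  refine Eventually.of_forall fun y => ?_
  exact Measure.pi_hyperplane (fun _ : {k // ¬ k = j} => ν) ⟨i, hij⟩ (y ⟨j, rfl⟩)

/-- Distinct points can be separated by disjoint bounded members of a countable basis, so countably
many boxes with disjoint sides cover the injective tuples. Subboxes of such a box again have
disjoint sides and form a π-system. -/
theorem restrict_injectiveTuples_congr {ι X : Type*} [Finite ι] [MetricSpace X]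
    [SecondCountableTopology X] [MeasurableSpace X] [BorelSpace X] {ρ₁ ρ₂ : Measure (ι → X)}
    (h : ∀ A : ι → Set X, (∀ i, MeasurableSet (A i)) → (∀ i, Bornology.IsBounded (A i)) →
      Pairwise (fun i j => Disjoint (A i) (A j)) →
      ρ₁ (Set.univ.pi A) = ρ₂ (Set.univ.pi A) ∧ ρ₂ (Set.univ.pi A) ≠ ∞) :
    ρ₁.restrict (injectiveTuples ι X) = ρ₂.restrict (injectiveTuples ι X) := by
  cases nonempty_fintype ι
  let J := {q : ι → TopologicalSpace.countableBasis X //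
    (∀ i, Bornology.IsBounded (q i).1) ∧ Pairwise (fun i j => Disjoint (q i).1 (q j).1)}
  have hJc : Countable J := inferInstance
  have hJm : ∀ (q : J) i, MeasurableSet (q.1 i).1 := fun q i =>
    (TopologicalSpace.isOpen_of_mem_countableBasis (q.1 i).2).measurableSet
  have hbox : ∀ q : J, ρ₁.restrict (Set.univ.pi fun i => (q.1 i).1)
      = ρ₂.restrict (Set.univ.pi fun i => (q.1 i).1) := by
    intro q
    have hq := h (fun i => (q.1 i).1) (hJm q) q.2.1 q.2.2
    have : IsFiniteMeasure (ρ₁.restrict (Set.univ.pi fun i => (q.1 i).1)) :=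
      isFiniteMeasure_restrict.2 (hq.1 ▸ hq.2)
    refine ext_of_generate_finite _ generateFrom_pi.symm isPiSystem_pi ?_ ?_
    · rintro _ ⟨A, hA, rfl⟩
      have hAm : ∀ i, MeasurableSet (A i) := fun i => hA i trivial
      rw [Measure.restrict_apply (MeasurableSet.univ_pi hAm),
        Measure.restrict_apply (MeasurableSet.univ_pi hAm), ← Set.pi_inter_distrib]
      exact (h _ (fun i => (hAm i).inter (hJm q i))
        (fun i => (q.2.1 i).subset Set.inter_subset_right)
        (fun i j hij => (q.2.2 hij).mono Set.inter_subset_right Set.inter_subset_right)).1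
    · simpa using hq.1
  refine Measure.restrict_congr_mono (t := ⋃ q : J, Set.univ.pi fun i => (q.1 i).1) ?_
    (Measure.restrict_iUnion_congr.2 hbox)
  intro x hx
  obtain ⟨U, hU, hUd⟩ := Set.Finite.t2_separation (Set.finite_range x)
  have hex : ∀ i, ∃ V ∈ TopologicalSpace.countableBasis X, x i ∈ V ∧
      V ⊆ U (x i) ∩ Metric.ball (x i) 1 := fun i =>
    (TopologicalSpace.isBasis_countableBasis X).exists_subset_of_mem_open
      ⟨(hU (x i)).1, Metric.mem_ball_self one_pos⟩ ((hU (x i)).2.inter Metric.isOpen_ball)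
  choose V hV hxV hVU using hex
  refine Set.mem_iUnion.2 ⟨⟨fun i => ⟨V i, hV i⟩, fun i =>
    Metric.isBounded_ball.subset ((hVU i).trans Set.inter_subset_right), fun i j hij => ?_⟩,
    fun i _ => hxV i⟩
  exact (hUd ⟨i, rfl⟩ ⟨j, rfl⟩ (fun he => hij (hx he))).mono
    ((hVU i).trans Set.inter_subset_left) ((hVU j).trans Set.inter_subset_left)

theorem restrict_injectiveTuples_pi {ι X : Type*} [Fintype ι] [MeasurableSpace X] [MeasurableEq X]
    (ν : Measure X) [SigmaFinite ν] [NullSingletonClass ν] :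
    (Measure.pi fun _ : ι => ν).restrict (injectiveTuples ι X) = Measure.pi fun _ => ν :=
  Measure.restrict_eq_self_of_ae_mem (by
    rw [ae_iff]; exact pi_injectiveTuples_compl ν)

/-- The tuples whose coordinates coincide exactly along the atoms of `π`. -/
def kernelTuples {n : ℕ} (π : Finpartition (Finset.univ : Finset (Fin n))) (X : Type*) :
    Set (Fin n → X) := {x | ∀ i j, x i = x j ↔ π.part i = π.part j}

/-- The map repeating along each atom of `π` the point attached to it. -/
def partsEmbedding {n : ℕ} (π : Finpartition (Finset.univ : Finset (Fin n))) {X : Type*}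
    (y : π.parts → X) (i : Fin n) : X := y ⟨π.part i, π.part_mem.2 (Finset.mem_univ i)⟩

section Partition

variable {n : ℕ} (π : Finpartition (Finset.univ : Finset (Fin n))) {X : Type*}

theorem exists_part_eq (Q : π.parts) : ∃ i, (⟨π.part i, π.part_mem.2 (Finset.mem_univ i)⟩ : π.parts) = Q := by
  obtain ⟨i, hi⟩ := π.nonempty_of_mem_parts Q.2
  exact ⟨i, Subtype.ext (π.part_eq_of_mem Q.2 hi)⟩

theorem partsEmbedding_injective : Function.Injective (partsEmbedding π (X := X)) := by
  intro y z h
  funext Q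
  obtain ⟨i, rfl⟩ := exists_part_eq π Q
  exact congrFun h i

theorem measurable_partsEmbedding [MeasurableSpace X] : Measurable (partsEmbedding π (X := X)) := by
  unfold partsEmbedding; fun_prop

theorem measurableSet_kernelTuples [MeasurableSpace X] [MeasurableEq X] :
    MeasurableSet (kernelTuples π X) := by
  have : kernelTuples π X = ⋂ (i) (j), {x : Fin n → X | x i = x j ↔ π.part i = π.part j} := by
    ext x; simp [kernelTuples]
  rw [this]
  refine .iInter fun i => .iInter fun j => ?_
  have h : MeasurableSet {x : Fin n → X | x i = x j} :=
    measurableSet_eq_fun (measurable_pi_apply i) (measurable_pi_apply j)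
  by_cases hij : π.part i = π.part j
  · simpa [hij] using h
  · have : {x : Fin n → X | x i = x j ↔ π.part i = π.part j} = {x : Fin n → X | x i = x j}ᶜ := by
      ext x; simp [hij]
    rw [this]
    exact h.compl

/-- A tuple that coincides exactly along `π` is recovered from its values at one representative `r
Q` of each atom, and these values are distinct. -/
theorem inter_kernelTuples_eq_image (E : Set (Fin n → X)) (s : Set X) :
    E ∩ kernelTuples π X ∩ Set.univ.pi (fun _ => s) =
      partsEmbedding π '' (partsEmbedding π ⁻¹' E ∩ injectiveTuples π.parts X ∩
        Set.univ.pi (fun _ => s)) := by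
  ext x
  constructor
  · rintro ⟨⟨hE, hk⟩, hs⟩
    choose r hr using exists_part_eq π
    have hx : partsEmbedding π (fun Q => x (r Q)) = x := by
      funext i
      refine (hk _ _).2 ?_
      exact congrArg Subtype.val (hr ⟨π.part i, π.part_mem.2 (Finset.mem_univ i)⟩)
    refine ⟨fun Q => x (r Q), ⟨⟨by rwa [Set.mem_preimage, hx], fun Q R h => ?_⟩,
      fun Q _ => hs _ trivial⟩, hx⟩
    rw [← hr Q, ← hr R]
    exact Subtype.ext ((hk _ _).1 h)
  · rintro ⟨y, ⟨⟨hE, hi⟩, hs⟩, rfl⟩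
    refine ⟨⟨hE, fun i j => ?_⟩, fun i _ => hs _ trivial⟩
    simp only [partsEmbedding]
    rw [hi.eq_iff, Subtype.mk.injEq]

theorem iUnion_kernelTuples :
    ⋃ π : Finpartition (Finset.univ : Finset (Fin n)), kernelTuples π X = Set.univ := by
  classical
  refine Set.eq_univ_of_forall fun x => Set.mem_iUnion.2
    ⟨Finpartition.ofSetoid (Setoid.ker x), fun i j => ?_⟩
  rw [← Finpartition.mem_part_iff_part_eq_part _ (Finset.mem_univ _) (Finset.mem_univ _),
    Finpartition.mem_part_ofSetoid_iff_rel, Setoid.ker_def, eq_comm]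

theorem pairwise_disjoint_kernelTuples : Pairwise (fun π ρ :
    Finpartition (Finset.univ : Finset (Fin n)) =>
      Disjoint (kernelTuples π X) (kernelTuples ρ X)) := by
  intro π ρ hne
  refine Set.disjoint_left.2 fun x h1 h2 => hne ?_
  have hp : ∀ i, π.part i = ρ.part i := by
    intro i
    ext j
    rw [Finpartition.mem_part_iff_part_eq_part _ (Finset.mem_univ _) (Finset.mem_univ _),
      Finpartition.mem_part_iff_part_eq_part _ (Finset.mem_univ _) (Finset.mem_univ _),
      ← h1 , ← h2]
  have hsub : ∀ {π ρ : Finpartition (Finset.univ : Finset (Fin n))},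
      (∀ i, π.part i = ρ.part i) → π.parts ⊆ ρ.parts := by
    intro π ρ hp Q hQ
    obtain ⟨i, hi⟩ := exists_part_eq π ⟨Q, hQ⟩
    have : π.part i = Q := congrArg Subtype.val hi
    rw [← this, hp]
    exact ρ.part_mem.2 (Finset.mem_univ i)
  exact Finpartition.ext ((hsub hp).antisymm (hsub fun i => (hp i).symm))

end Partition

/-- Both sides count the same points of a power of the support, through an injection. This uses that
every point of `ξ` has mass one. -/
theorem IsSimpleCounting.pi_inter_kernelTuples {X : Type*} [MetricSpace X]
    [SecondCountableTopology X] [MeasurableSpace X] [BorelSpace X] {ξ : Measure X}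
    (h : IsSimpleCounting ξ) {n : ℕ} (π : Finpartition (Finset.univ : Finset (Fin n)))
    {E : Set (Fin n → X)} (hE : MeasurableSet E) :
    Measure.pi (fun _ => ξ) (E ∩ kernelTuples π X) =
      Measure.pi (fun _ : π.parts => ξ) (partsEmbedding π ⁻¹' E ∩ injectiveTuples π.parts X) := by
  obtain ⟨s, hs, -, hcount⟩ := h.exists_pi_apply_eq_count
  have hm := (measurable_partsEmbedding π hE).inter
    (measurableSet_injectiveTuples (ι := π.parts) (X := X))
  rw [hcount _ _ (hE.inter (measurableSet_kernelTuples π)), hcount _ _ hm,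
    inter_kernelTuples_eq_image, Measure.count_injective_image (partsEmbedding_injective π)]

/-! ### Moment measures of a Poisson process -/

theorem lintegral_natCast_poissonMeasure (r : ℝ≥0) :
    ∫⁻ j : ℕ, (j : ℝ≥0∞) ∂(poissonMeasure r) = r := by
  have hs : HasSum (fun n : ℕ => Real.exp (-r) * r ^ (n + 1) / n.factorial) r := by
    have := (NormedSpace.expSeries_div_hasSum_exp (r : ℝ)).mul_left (Real.exp (-r) * r)
    rw [← Real.exp_eq_exp_ℝ] at this
    have h1 : Real.exp (-r) * r * Real.exp r = r := by
      rw [mul_right_comm, ← Real.exp_add]; simp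
    rw [h1] at this
    refine this.congr_fun fun n => ?_
    ring
  rw [lintegral_countable', tsum_eq_zero_add' ENNReal.summable]
  have hterm : ∀ n : ℕ, ((n + 1 : ℕ) : ℝ≥0∞) * poissonMeasure r {n + 1}
      = ENNReal.ofReal (Real.exp (-r) * r ^ (n + 1) / n.factorial) := by
    intro n
    rw [poissonMeasure_singleton, ← ENNReal.ofReal_natCast, ← ENNReal.ofReal_mul (by positivity)]
    congr 1
    rw [Nat.factorial_succ]
    push_cast
    field_simp
  simp only [hterm, Nat.cast_zero, zero_mul, zero_add]
  rw [← ENNReal.ofReal_tsum_of_nonneg (fun n => by positivity) hs.summable, hs.tsum_eq,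
    ENNReal.ofReal_coe_nnreal]

theorem IsPoissonProcess.lintegral_eq {X Ω : Type*} [MetricSpace X] [MeasurableSpace X]
    [MeasurableSpace Ω] {ν : Measure X} {P : Measure Ω} {N : Ω → Measure X}
    (hN : IsPoissonProcess ν P N) {A : Set X} (hA : MeasurableSet A) (hAf : ν A < ∞) :
    ∫⁻ ω, N ω A ∂P = ν A := by
  have h1 : ∫⁻ ω, N ω A ∂P = ∫⁻ y, y ∂(P.map fun ω => N ω A) :=
    (lintegral_map (f := fun y => y) measurable_id
      ((Measure.measurable_coe hA).comp hN.measurable)).symm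
  rw [h1, hN.law A hA hAf, lintegral_map (f := fun y => y) measurable_id .of_discrete,
    lintegral_natCast_poissonMeasure, ENNReal.coe_toNNReal hAf.ne]

/-- On a box with disjoint sides, independence turns the expectation of the product into the product
of the means; such boxes suffice off the diagonals. -/
theorem IsPoissonProcess.bind_pi_restrict {ι X Ω : Type*} [Fintype ι] [MetricSpace X]
    [SecondCountableTopology X] [MeasurableSpace X] [BorelSpace X] [MeasurableSpace Ω]
    {ν : Measure X} [NullSingletonClass ν] (hν : IsBoundedlyFinite ν) {P : Measure Ω}
    {N : Ω → Measure X} (hN : IsPoissonProcess ν P N) :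
    (P.bind fun ω => Measure.pi fun _ : ι => N ω).restrict (injectiveTuples ι X) =
      Measure.pi fun _ => ν := by
  have hsf : SigmaFinite ν := hν.sigmaFinite
  have hb := fun ω => (hN.simpleCounting ω).isBoundedlyFinite
  have hNsf : ∀ ω, SigmaFinite (N ω) := fun ω => (hb ω).sigmaFinite
  rw [← restrict_injectiveTuples_pi ν]
  refine restrict_injectiveTuples_congr fun A hA hAb hAd => ?_
  have hAf : ∀ i, ν (A i) < ∞ := fun i => hν _ (hA i) (hAb i)
  rw [Measure.bind_apply (MeasurableSet.univ_pi hA) (measurable_measure_pi hN.measurable hb).aemeasurable]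
  simp only [Measure.pi_pi]
  refine ⟨?_, (ENNReal.prod_lt_top fun i _ => hAf i).ne⟩
  let e := (Fintype.equivFin ι).symm
  have hind := hN.indep _ (fun k => A (e k)) (fun k => hA _) (fun k => hAf _)
    (fun i j hij => hAd (e.injective.ne hij))
  have := lintegral_prod_eq_prod_lintegral_of_indepFun Finset.univ _ hind
    (fun k => (Measure.measurable_coe (hA (e k))).comp hN.measurable)
  simp only [hN.lintegral_eq (hA _) (hAf _)] at this
  rw [e.prod_comp (fun i => ν (A i))] at this
  rw [← this]
  exact lintegral_congr fun ω => (e.prod_comp (fun i => N ω (A i))).symm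

theorem pi_nnreal_smul {ι X : Type*} [Fintype ι] [MeasurableSpace X] (μ : Measure X)
    [SigmaFinite μ] (a : ℝ≥0) :
    Measure.pi (fun _ : ι => a • μ) = a ^ Fintype.card ι • Measure.pi fun _ => μ := by
  refine Measure.pi_eq fun A _ => ?_
  simp only [Measure.smul_apply, Measure.pi_pi, ENNReal.smul_def, smul_eq_mul,
    Finset.prod_mul_distrib, Finset.prod_const, Finset.card_univ, ENNReal.coe_pow]

/-- The piece with coincidence pattern `π` is the image of the off-diagonal moment measure of order
`|π|`, which is `(a • μ)^|π|`; hence the coefficient. -/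
theorem IsPoissonProcess.momentMeasure_eq {X Ω : Type*} [MetricSpace X]
    [SecondCountableTopology X] [MeasurableSpace X] [BorelSpace X] [MeasurableSpace Ω]
    {μ : Measure X} [NullSingletonClass μ] (hμ : IsBoundedlyFinite μ) {a : ℝ≥0} {P : Measure Ω}
    {N : Ω → Measure X} (hN : IsPoissonProcess (a • μ) P N) (n : ℕ) :
    momentMeasure P N n = ∑ π, a ^ π.parts.card • partitionMeasure μ π := by
  have hsf : SigmaFinite μ := hμ.sigmaFinite
  have hν : IsBoundedlyFinite (a • μ) := fun B hB hBb => by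
    rw [Measure.smul_apply]; exact ENNReal.mul_lt_top ENNReal.coe_lt_top (hμ B hB hBb)
  have hνn : NullSingletonClass (a • μ) := ⟨fun x => by simp⟩
  have hb := fun ω => (hN.simpleCounting ω).isBoundedlyFinite
  refine Measure.ext fun E hE => ?_
  have hsplit : E = ⋃ π : Finpartition (Finset.univ : Finset (Fin n)), E ∩ kernelTuples π X := by
    rw [← Set.inter_iUnion, iUnion_kernelTuples, Set.inter_univ]
  conv_lhs => rw [hsplit]
  rw [measure_iUnion (fun π ρ h => (pairwise_disjoint_kernelTuples h).mono Set.inter_subset_right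
    Set.inter_subset_right) (fun π => hE.inter (measurableSet_kernelTuples π)), tsum_fintype,
    Measure.finsetSum_apply]
  refine Finset.sum_congr rfl fun π _ => ?_
  have hφE := measurable_partsEmbedding π hE
  have hinj := measurableSet_injectiveTuples (ι := π.parts) (X := X)
  rw [momentMeasure, Measure.bind_apply (hE.inter (measurableSet_kernelTuples π))
    (measurable_measure_pi hN.measurable hb).aemeasurable]
  simp only [fun ω => (hN.simpleCounting ω).pi_inter_kernelTuples π hE]
  rw [← Measure.bind_apply (hφE.inter hinj) (measurable_measure_pi hN.measurable hb).aemeasurable,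
    ← Measure.restrict_apply hφE, hN.bind_pi_restrict hν, pi_nnreal_smul, partitionMeasure,
    Measure.smul_apply, Measure.smul_apply, Fintype.card_coe]
  congr 1
  exact (Measure.map_apply (measurable_partsEmbedding π) hE).symm

/-! ### Ergodicity of a Poisson process -/

theorem measurable_measure_restrict {X : Type*} [MeasurableSpace X] {B : Set X}
    (hB : MeasurableSet B) : Measurable fun ξ : Measure X => ξ.restrict B :=
  Measure.measurable_of_measurable_coe _ fun A hA => by
    simp only [Measure.restrict_apply hA]
    exact Measure.measurable_coe (hA.inter hB)

theorem ae_eq_of_forall_ae_apply_eq {X Ω : Type*} [MetricSpace X] [SecondCountableTopology X]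
    [MeasurableSpace X] [BorelSpace X] [MeasurableSpace Ω] {P : Measure Ω} {N N' : Ω → Measure X}
    (hb : ∀ ω, IsBoundedlyFinite (N ω))
    (h : ∀ A, MeasurableSet A → ∀ᵐ ω ∂P, N ω A = N' ω A) : N =ᵐ[P] N' := by
  rcases isEmpty_or_nonempty X with hX | ⟨⟨x⟩⟩
  · exact Eventually.of_forall fun ω => by
      rw [Measure.eq_zero_of_isEmpty (N ω), Measure.eq_zero_of_isEmpty (N' ω)]
  -- The balls are added to the basis so that the generated algebra, still countable, contains an
  -- exhaustion by sets of finite `N ω`-measure.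
  let 𝒢 : Set (Set X) := TopologicalSpace.countableBasis X ∪ Set.range fun k : ℕ => Metric.ball x k
  have h𝒢c : 𝒢.Countable :=
    (TopologicalSpace.countable_countableBasis X).union (Set.countable_range _)
  have h𝒢o : ∀ s ∈ 𝒢, IsOpen s := by
    rintro s (hs | ⟨k, rfl⟩)
    · exact TopologicalSpace.isOpen_of_mem_countableBasis hs
    · exact Metric.isOpen_ball
  have hgen : ‹MeasurableSpace X› = MeasurableSpace.generateFrom 𝒢 := by
    apply le_antisymm
    · rw [BorelSpace.measurable_eq (α := X),
        (TopologicalSpace.isBasis_countableBasis X).borel_eq_generateFrom]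
      exact MeasurableSpace.generateFrom_mono Set.subset_union_left
    · exact MeasurableSpace.generateFrom_le fun s hs => (h𝒢o s hs).measurableSet
  have hgen' : ‹MeasurableSpace X› = MeasurableSpace.generateFrom (generateSetAlgebra 𝒢) := by
    rw [generateFrom_generateSetAlgebra_eq]; exact hgen
  have hall : ∀ᵐ ω ∂P, ∀ s ∈ generateSetAlgebra 𝒢, N ω s = N' ω s := by
    refine (ae_ball_iff (countable_generateSetAlgebra h𝒢c)).2 fun s hs => h s ?_
    rw [hgen']
    exact MeasurableSpace.measurableSet_generateFrom hs
  filter_upwards [hall] with ω hω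
  refine Measure.ext_of_generateFrom_of_iUnion _ (fun k : ℕ => Metric.ball x k) hgen'
    isSetAlgebra_generateSetAlgebra.isSetRing.isSetSemiring.isPiSystem
    (Metric.iUnion_ball_nat x) (fun k => ?_)
    (fun k => (hb ω _ measurableSet_ball Metric.isBounded_ball).ne) hω
  exact self_subset_generateSetAlgebra (Or.inr ⟨k, rfl⟩)

/-- Equivariance has an exceptional null set for each `A`; a countable generating algebra gives a
common one, so `N ∘ S` and `T_* N` agree almost surely as measures. -/
theorem IsTRandomMeasure.measurePreserving_map {X Ω : Type*} [MetricSpace X]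
    [SecondCountableTopology X] [MeasurableSpace X] [BorelSpace X] [MeasurableSpace Ω]
    {μ : Measure X} {T : X ≃ᵐ X} {P : Measure Ω} {S : Ω ≃ᵐ Ω} {N : Ω → Measure X}
    (hN : IsTRandomMeasure μ T P S N) :
    MeasurePreserving (fun ξ : Measure X => ξ.map T) (P.map N) (P.map N) := by
  have hm : Measurable fun ξ : Measure X => ξ.map T := Measure.measurable_map _ T.measurable
  refine ⟨hm, ?_⟩
  have hae : N ∘ S =ᵐ[P] fun ω => (N ω).map T :=
    ae_eq_of_forall_ae_apply_eq (fun ω => hN.boundedlyFinite _) fun A hA => by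
      filter_upwards [hN.equivariant A hA] with ω hω
      rw [Measure.map_apply T.measurable hA]
      exact hω
  rw [Measure.map_map hm hN.measurable]
  calc P.map ((fun ξ : Measure X => ξ.map T) ∘ N) = P.map (N ∘ S) := (Measure.map_congr hae).symm
    _ = P.map N := by
      rw [← Measure.map_map hN.measurable S.measurable, hN.measurePreserving.map_eq]

theorem iterate_measure_map {X : Type*} [MeasurableSpace X] {T : X → X} (hT : Measurable T)
    (n : ℕ) (ξ : Measure X) : (fun ξ : Measure X => ξ.map T)^[n] ξ = ξ.map T^[n] := by
  induction n with
  | zero => simp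
  | succ n ih =>
    rw [Function.iterate_succ_apply', ih, Measure.map_map hT (hT.iterate n),
      Function.iterate_succ']

theorem measure_inter_eq_sum_inter_preimage_singleton {X W : Type*} [MeasurableSpace X] [Fintype W]
    (ξ : Measure X) {A B : Set X} {c : X → W} (hA : MeasurableSet A) (hB : MeasurableSet B)
    (hc : ∀ w, MeasurableSet (c ⁻¹' {w})) :
    ξ (A ∩ B) = ∑ w, ξ (A ∩ (B ∩ c ⁻¹' {w})) := by
  have hun : A ∩ B = ⋃ w, A ∩ (B ∩ c ⁻¹' {w}) := by
    ext x
    simp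
  rw [hun, measure_iUnion (fun v w hvw => ?_) (fun w => hA.inter (hB.inter (hc w))), tsum_fintype]
  · refine Set.disjoint_left.2 fun x h1 h2 => hvw ?_
    have h1 : c x = v := h1.2.2
    have h2 : c x = w := h2.2.2
    exact h1.symm.trans h2

theorem IsPoissonProcess.iIndepFun_fintype {X Ω W : Type*} [Fintype W] [MetricSpace X]
    [MeasurableSpace X] [MeasurableSpace Ω] {ν : Measure X} {P : Measure Ω} {N : Ω → Measure X}
    (hN : IsPoissonProcess ν P N) {A : W → Set X} (hA : ∀ i, MeasurableSet (A i))
    (hf : ∀ i, ν (A i) < ∞) (hd : Pairwise fun i j => Disjoint (A i) (A j)) :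
    iIndepFun (fun i ω => N ω (A i)) P := by
  let e := Fintype.equivFin W
  have := (hN.indep _ (fun k => A (e.symm k)) (fun k => hA _) (fun k => hf _)
    (fun i j hij => hd (e.symm.injective.ne hij))).precomp e.injective
  simpa using this

open Classical in
-- The sets of a family may overlap, so `B` and `C` are cut into the cells of points with the same
-- membership pattern `w`. The cells are disjoint, and each value is a sum over the cells whose
-- pattern satisfies `w i`.
theorem IsPoissonProcess.indepFun_inter_family {X Ω I J : Type*} [Fintype I] [Fintype J]
    [MetricSpace X] [MeasurableSpace X] [MeasurableSpace Ω] {ν : Measure X} {P : Measure Ω}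
    {N : Ω → Measure X} (hN : IsPoissonProcess ν P N) {B C : Set X} (hB : MeasurableSet B)
    (hC : MeasurableSet C) (hBf : ν B < ∞) (hCf : ν C < ∞) (hBC : Disjoint B C)
    {A : I → Set X} {A' : J → Set X} (hA : ∀ i, MeasurableSet (A i))
    (hA' : ∀ j, MeasurableSet (A' j)) :
    IndepFun (fun ω i => N ω (A i ∩ B)) (fun ω j => N ω (A' j ∩ C)) P := by
  let c : X → (I → Prop) := fun x i => x ∈ A i
  let c' : X → (J → Prop) := fun x j => x ∈ A' j
  have hc : ∀ w, MeasurableSet (c ⁻¹' {w}) := fun w =>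
    (measurable_pi_lambda c fun i => measurable_mem.2 (hA i)) (measurableSet_singleton w)
  have hc' : ∀ w, MeasurableSet (c' ⁻¹' {w}) := fun w =>
    (measurable_pi_lambda c' fun j => measurable_mem.2 (hA' j)) (measurableSet_singleton w)
  let D : (I → Prop) ⊕ (J → Prop) → Set X :=
    Sum.elim (fun w => B ∩ c ⁻¹' {w}) (fun w => C ∩ c' ⁻¹' {w})
  have hD : ∀ w, MeasurableSet (D w) := by
    rintro (w | w)
    · exact hB.inter (hc w)
    · exact hC.inter (hc' w)
  have hDf : ∀ w, ν (D w) < ∞ := by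
    rintro (w | w)
    · exact (measure_mono Set.inter_subset_left).trans_lt hBf
    · exact (measure_mono Set.inter_subset_left).trans_lt hCf
  have hDd : Pairwise fun v w => Disjoint (D v) (D w) := by
    rintro (v | v) (w | w) hvw <;> refine Set.disjoint_left.2 fun x h1 h2 => ?_
    · exact hvw (congrArg Sum.inl ((show c x = v from h1.2).symm.trans h2.2))
    · exact Set.disjoint_left.1 hBC h1.1 h2.1
    · exact Set.disjoint_left.1 hBC h2.1 h1.1
    · exact hvw (congrArg Sum.inr ((show c' x = v from h1.2).symm.trans h2.2))
  have hind := hN.iIndepFun_fintype hD hDf hDd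
  have hpair := hind.indepFun_finset (Finset.univ.image Sum.inl) (Finset.univ.image Sum.inr)
    (by
      rw [Finset.disjoint_left]
      rintro w h1 h2
      simp only [Finset.mem_image, Finset.mem_univ, true_and] at h1 h2
      obtain ⟨u, rfl⟩ := h1
      obtain ⟨v, hv⟩ := h2
      cases hv)
    (fun w => (Measure.measurable_coe (hD w)).comp hN.measurable)
  let φ : ((Finset.univ.image (Sum.inl : (I → Prop) → (I → Prop) ⊕ (J → Prop)) : Finset _) → ℝ≥0∞)
      → I → ℝ≥0∞ := fun v i => ∑ w : I → Prop, if w i then v ⟨Sum.inl w, by simp⟩ else 0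
  let ψ : ((Finset.univ.image (Sum.inr : (J → Prop) → (I → Prop) ⊕ (J → Prop)) : Finset _) → ℝ≥0∞)
      → J → ℝ≥0∞ := fun v j => ∑ w : J → Prop, if w j then v ⟨Sum.inr w, by simp⟩ else 0
  have hφ : Measurable φ := measurable_pi_lambda _ fun i => Finset.measurable_sum _ fun w _ => by
    split_ifs
    · exact measurable_pi_apply _
    · exact measurable_const
  have hψ : Measurable ψ := measurable_pi_lambda _ fun j => Finset.measurable_sum _ fun w _ => by
    split_ifs
    · exact measurable_pi_apply _
    · exact measurable_const
  convert hpair.comp hφ hψ using 1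
  · funext ω i
    rw [measure_inter_eq_sum_inter_preimage_singleton (N ω) (hA i) hB hc]
    refine Finset.sum_congr rfl fun w _ => ?_
    split_ifs with h
    · congr 1
      refine Set.inter_eq_right.2 fun x hx => ?_
      have : c x = w := hx.2
      rw [← this] at h
      exact h
    · rw [Set.disjoint_iff_inter_eq_empty.1, measure_empty]
      refine Set.disjoint_left.2 fun x h1 h2 => h ?_
      have : c x = w := h2.2
      rw [← this]
      exact h1
  · funext ω i
    rw [measure_inter_eq_sum_inter_preimage_singleton (N ω) (hA' i) hC hc']
    refine Finset.sum_congr rfl fun w _ => ?_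
    split_ifs with h
    · congr 1
      refine Set.inter_eq_right.2 fun x hx => ?_
      have : c' x = w := hx.2
      rw [← this] at h
      exact h
    · rw [Set.disjoint_iff_inter_eq_empty.1, measure_empty]
      refine Set.disjoint_left.2 fun x h1 h2 => h ?_
      have : c' x = w := h2.2
      rw [← this]
      exact h1

theorem IsPoissonProcess.indepFun_restrict {X Ω : Type*} [MetricSpace X] [MeasurableSpace X]
    [MeasurableSpace Ω] {ν : Measure X} {P : Measure Ω} [IsProbabilityMeasure P]
    {N : Ω → Measure X} (hN : IsPoissonProcess ν P N) {B C : Set X} (hB : MeasurableSet B)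
    (hC : MeasurableSet C) (hBf : ν B < ∞) (hCf : ν C < ∞) (hBC : Disjoint B C) :
    IndepFun (fun ω => (N ω).restrict B) (fun ω => (N ω).restrict C) P := by
  have hm : ∀ {D : Set X}, MeasurableSet D → ∀ A : {A : Set X // MeasurableSet A},
      Measurable fun ω => N ω (A.1 ∩ D) := fun hD A =>
    (Measure.measurable_coe (A.2.inter hD)).comp hN.measurable
  have hproc : IndepFun (fun ω (A : {A : Set X // MeasurableSet A}) => N ω (A.1 ∩ B))
      (fun ω (A : {A : Set X // MeasurableSet A}) => N ω (A.1 ∩ C)) P :=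
    IndepFun.process_indepFun_process (hm hB) (hm hC) fun I J =>
      hN.indepFun_inter_family hB hC hBf hCf hBC (fun i => i.1.2) (fun j => j.1.2)
  have hle : ∀ D : Set X, MeasurableSpace.comap (fun ω => (N ω).restrict D) inferInstance ≤
      MeasurableSpace.comap (fun ω (A : {A : Set X // MeasurableSet A}) => N ω (A.1 ∩ D))
        inferInstance := by
    intro D
    rw [← measurable_iff_comap_le]
    refine Measure.measurable_of_measurable_coe _ fun A hA => ?_
    simp only [Measure.restrict_apply hA]
    exact (show Measurable fun v : {A : Set X // MeasurableSet A} → ℝ≥0∞ => v ⟨A, hA⟩ from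
      measurable_pi_apply _).comp (comap_measurable _)
  exact indep_of_indep_of_le hproc (hle B) (hle C)

/-- Approximating `E = E ∩ E` by `F ∩ G` gives `m E = (m E)²`. -/
theorem measure_eq_zero_or_one_of_approx_indep {α : Type*} [MeasurableSpace α] {m : Measure α}
    [IsProbabilityMeasure m] {E : Set α}
    (h : ∀ ε : ℝ, 0 < ε → ∃ F G : Set α, m.real (symmDiff E F) ≤ ε ∧ m.real (symmDiff E G) ≤ ε ∧
      m.real (F ∩ G) = m.real F * m.real G) : m E = 0 ∨ m E = 1 := by
  have hsub : ∀ {A B : Set α}, m.real A ≤ m.real B + m.real (symmDiff A B) := fun {A B} => by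
    refine (measureReal_mono (s₂ := B ∪ symmDiff A B) fun x hx => ?_).trans (measureReal_union_le _ _)
    by_cases hxB : x ∈ B
    · exact Or.inl hxB
    · exact Or.inr (Or.inl ⟨hx, hxB⟩)
  have habs : ∀ {A B : Set α} {ε : ℝ}, m.real (symmDiff A B) ≤ ε → |m.real A - m.real B| ≤ ε := by
    intro A B ε h
    rw [abs_le]
    have h1 := hsub (A := A) (B := B)
    have h2 := hsub (A := B) (B := A)
    rw [symmDiff_comm] at h2
    constructor <;> linarith
  have hsq : m.real E = m.real E * m.real E := by
    refine eq_of_abs_sub_le_all fun ε hε => ?_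
    obtain ⟨F, G, hF, hG, hFG⟩ := h (ε / 4) (by positivity)
    have h1 : m.real (symmDiff E (F ∩ G)) ≤ ε / 4 + ε / 4 := by
      refine ((measureReal_mono (s₂ := symmDiff E F ∪ symmDiff E G) ?_).trans
        (measureReal_union_le _ _)).trans (add_le_add hF hG)
      intro x hx
      simp only [Set.mem_symmDiff, Set.mem_inter_iff, Set.mem_union] at hx ⊢
      tauto
    have a1 := abs_le.1 (habs h1)
    have a2 := abs_le.1 (habs hF)
    have a3 := abs_le.1 (habs hG)
    rw [hFG] at a1
    have e0 : 0 ≤ m.real E := measureReal_nonneg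
    have e1 : m.real E ≤ 1 := measureReal_le_one
    have f0 : 0 ≤ m.real G := measureReal_nonneg
    have f1 : m.real G ≤ 1 := measureReal_le_one
    have b1 : |m.real E * (m.real E - m.real G)| ≤ ε / 4 := by
      rw [abs_mul, abs_of_nonneg e0]
      exact (mul_le_of_le_one_left (abs_nonneg _) e1).trans (habs hG)
    have b2 : |(m.real E - m.real F) * m.real G| ≤ ε / 4 := by
      rw [abs_mul, abs_of_nonneg f0]
      exact (mul_le_of_le_one_right (abs_nonneg _) f1).trans (habs hF)
    have c1 := abs_le.1 b1
    have c2 := abs_le.1 b2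
    rw [abs_le]
    constructor <;> nlinarith
  have hcases : m.real E = 0 ∨ m.real E = 1 := by
    rcases eq_or_ne (m.real E) 0 with h0 | h0
    · exact Or.inl h0
    · exact Or.inr (mul_left_cancel₀ h0 (by rw [mul_one]; exact hsq.symm))
  rcases hcases with h0 | h0
  · exact Or.inl ((measureReal_eq_zero_iff).1 h0)
  · refine Or.inr ?_
    rw [← ofReal_measureReal, h0, ENNReal.ofReal_one]

/-- Events seen in some ball about `x` form an algebra, as two balls fit in the larger one. It
generates the σ-algebra because `ξ A` is the supremum of the masses of `A` within the balls; such an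
algebra is dense for a finite measure. -/
theorem exists_ball_approx {X : Type*} [MetricSpace X] [MeasurableSpace X] [BorelSpace X] (x : X)
    (m : Measure (Measure X)) [IsFiniteMeasure m] {E : Set (Measure X)} (hE : MeasurableSet E)
    {ε : ℝ} (hε : 0 < ε) :
    ∃ (r : ℕ) (F : Set (Measure X)), MeasurableSet F ∧
      m (symmDiff E ((fun ξ => ξ.restrict (Metric.ball x r)) ⁻¹' F)) < ENNReal.ofReal ε := by
  let ρ : ℕ → Measure X → Measure X := fun r ξ => ξ.restrict (Metric.ball x r)
  have hρ : ∀ r, Measurable (ρ r) := fun r => measurable_measure_restrict measurableSet_ball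
  let 𝒜 : Set (Set (Measure X)) := {G | ∃ (r : ℕ) (F : Set (Measure X)), MeasurableSet F ∧ ρ r ⁻¹' F = G}
  have hmono : ∀ {r s : ℕ}, r ≤ s → ρ r = ρ r ∘ ρ s := by
    intro r s hrs
    funext ξ
    simp only [ρ, Function.comp]
    rw [Measure.restrict_restrict measurableSet_ball,
      Set.inter_eq_left.2 (Metric.ball_subset_ball (by exact_mod_cast hrs))]
  have halg : IsSetAlgebra 𝒜 := by
    refine ⟨⟨0, ∅, .empty, rfl⟩, ?_, ?_⟩
    · rintro _ ⟨r, F, hF, rfl⟩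
      exact ⟨r, Fᶜ, hF.compl, rfl⟩
    · rintro _ _ ⟨r, F, hF, rfl⟩ ⟨s, G, hG, rfl⟩
      refine ⟨max r s, ρ r ⁻¹' F ∪ ρ s ⁻¹' G, (hρ r hF).union (hρ s hG), ?_⟩
      rw [Set.preimage_union, ← Set.preimage_comp, ← Set.preimage_comp,
        ← hmono (le_max_left r s), ← hmono (le_max_right r s)]
  have hgen : (Measure.instMeasurableSpace : MeasurableSpace (Measure X))
      = MeasurableSpace.generateFrom 𝒜 := by
    apply le_antisymm
    · have hid : @Measurable _ _ (MeasurableSpace.generateFrom 𝒜) Measure.instMeasurableSpace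
          (id : Measure X → Measure X) := by
        refine @Measure.measurable_of_measurable_coe X (Measure X) _ (MeasurableSpace.generateFrom 𝒜) id
          fun A hA => ?_
        have : (fun ξ : Measure X => (id ξ : Measure X) A) = fun ξ => ⨆ r : ℕ, ρ r ξ A := by
          funext ξ
          simp only [ρ, Measure.restrict_apply hA, id]
          rw [← (Monotone.measure_iUnion fun a b hab => Set.inter_subset_inter_right _
              (Metric.ball_subset_ball (by exact_mod_cast hab))),
            ← Set.inter_iUnion, Metric.iUnion_ball_nat, Set.inter_univ]
        rw [this]
        refine .iSup fun r => ?_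
        have hr : @Measurable _ _ (MeasurableSpace.generateFrom 𝒜) _ (ρ r) := fun F hF =>
          MeasurableSpace.measurableSet_generateFrom ⟨r, F, hF, rfl⟩
        exact (Measure.measurable_coe hA).comp hr
      exact fun s hs => hid hs
    · refine MeasurableSpace.generateFrom_le ?_
      rintro _ ⟨r, F, hF, rfl⟩
      exact hρ r hF
  obtain ⟨_, ⟨r, F, hF, rfl⟩, ht⟩ :=
    (Measure.MeasureDense.of_generateFrom_isSetAlgebra_finite (μ := m) halg hgen).approx E hE
      (measure_ne_top _ _) ε hε
  exact ⟨r, F, hF, ht⟩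

theorem IsPoissonProcess.isErgodicProcess {X Ω : Type*} [MetricSpace X]
    [SecondCountableTopology X] [MeasurableSpace X] [BorelSpace X] [MeasurableSpace Ω]
    {μ : Measure X} (hμ : IsBoundedlyFinite μ) {T : X ≃ᵐ X} (hT : MeasurePreserving T μ μ)
    (hT_inv : ∀ A : Set X, MeasurableSet A → T ⁻¹' A = A → μ A = 0 ∨ μ A = ∞)
    {P : Measure Ω} [IsProbabilityMeasure P] {N : Ω → Measure X} {a : ℝ≥0}
    (hN : IsPoissonProcess (a • μ) P N)
    (hmp : MeasurePreserving (fun ξ : Measure X => ξ.map T) (P.map N) (P.map N)) :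
    IsErgodicProcess T P N := by
  refine ⟨hmp, ⟨fun E hE hinv => ?_⟩⟩
  have hprob : IsProbabilityMeasure (P.map N) := Measure.isProbabilityMeasure_map hN.measurable.aemeasurable
  have hsmul : ∀ A : Set X, (a • μ) A = a * μ A := fun A => by
    rw [Measure.smul_apply]; rfl
  suffices h : (P.map N) E = 0 ∨ (P.map N) E = 1 by
    rw [eventuallyConst_set']
    rcases h with h | h
    · exact Or.inl (ae_eq_empty.2 h)
    · exact Or.inr (ae_eq_univ.2 ((prob_compl_eq_zero_iff hE).2 h))
  rcases isEmpty_or_nonempty X with hX | ⟨⟨x⟩⟩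
  · rcases E.eq_empty_or_nonempty with rfl | h
    · simp
    · rw [Subsingleton.eq_univ_of_nonempty h]; simp
  refine measure_eq_zero_or_one_of_approx_indep fun ε hε => ?_
  obtain ⟨r, F, hF, hEF⟩ := exists_ball_approx x (P.map N) hE (half_pos hε)
  set B := Metric.ball x (r : ℝ) with hB
  have hBm : MeasurableSet B := measurableSet_ball
  have hBf : μ B < ∞ := hμ _ hBm Metric.isBounded_ball
  -- The expected number of points in `B ∩ T⁻ⁿ B` must be at most `ε / 2`; dividing by `a + 1`
  -- rather than `a` also covers `a = 0`.
  obtain ⟨n, hn⟩ := exists_measure_inter_preimage_iterate_lt hT hT_inv hBm hBf.ne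
    (ε := ENNReal.ofReal (ε / 2) / (a + 1))
    (ENNReal.div_ne_zero.2 ⟨by simpa using hε, by simp⟩)
  have hTn := hT.iterate n
  set B' := T^[n] ⁻¹' B with hB'
  have hB'm : MeasurableSet B' := hTn.measurable hBm
  have hB'f : μ B' < ∞ := by rw [hB', hTn.measure_preimage hBm.nullMeasurableSet]; exact hBf
  have hC : MeasurableSet (B' \ B) := hB'm.diff hBm
  let ρ : Set X → Measure X → Measure X := fun D ξ => ξ.restrict D
  have hρ : ∀ {D}, MeasurableSet D → Measurable (ρ D) := measurable_measure_restrict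
  let τ : Measure X → Measure X := fun ξ => ξ.map T^[n]
  have hτ : Measurable τ := Measure.measurable_map _ hTn.measurable
  have hτmp : MeasurePreserving τ (P.map N) (P.map N) := by
    have h1 := hmp.iterate n
    have h2 : (fun ξ : Measure X => ξ.map T)^[n] = τ := funext fun ξ =>
      iterate_measure_map T.measurable n ξ
    rwa [h2] at h1
  have hτE : τ ⁻¹' E = E := by
    have h2 : (fun ξ : Measure X => ξ.map T)^[n] = τ := funext fun ξ =>
      iterate_measure_map T.measurable n ξ
    rw [← h2, Set.preimage_iterate_eq]
    exact Function.iterate_fixed hinv n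
  have hFm : MeasurableSet (ρ B ⁻¹' F) := hρ hBm hF
  have hGm : MeasurableSet (ρ (B' \ B) ⁻¹' (τ ⁻¹' F)) := hρ hC (hτ hF)
  refine ⟨ρ B ⁻¹' F, ρ (B' \ B) ⁻¹' (τ ⁻¹' F), ?_, ?_, ?_⟩
  · exact (ENNReal.toReal_le_of_le_ofReal (half_pos hε).le hEF.le).trans (by linarith)
  · refine ENNReal.toReal_le_of_le_ofReal hε.le ?_
    -- By invariance `τ ⁻¹' F`, seen through `B'`, approximates `E` as well as `F` does. Removing
    -- `B` from `B'` makes the two events independent and changes something only if `B ∩ B'` is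
    -- charged.
    have hsub : symmDiff E (ρ (B' \ B) ⁻¹' (τ ⁻¹' F)) ⊆
        τ ⁻¹' (symmDiff E (ρ B ⁻¹' F)) ∪ {ξ | ξ (B ∩ B') ≠ 0} := by
      intro ξ hξ
      by_cases h0 : ξ (B ∩ B') = 0
      · left
        have h1 : ρ (B' \ B) ξ = ρ B' ξ := by
          refine Measure.restrict_congr_set ?_
          refine (sdiff_ae_eq_self.2 ?_)
          rwa [Set.inter_comm]
        have h2 : ρ B (τ ξ) = τ (ρ B' ξ) := Measure.restrict_map hTn.measurable hBm
        have h3 : τ ξ ∈ E ↔ ξ ∈ E := by rw [← Set.mem_preimage, hτE]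
        simp only [Set.mem_symmDiff, Set.mem_preimage, h1, h2, h3] at hξ ⊢
        exact hξ
      · exact Or.inr h0
    refine (measure_mono hsub).trans ((measure_union_le _ _).trans ?_)
    have hsd : MeasurableSet (symmDiff E (ρ B ⁻¹' F)) := hE.symmDiff hFm
    rw [hτmp.measure_preimage hsd.nullMeasurableSet]
    have hmark : (P.map N) {ξ | ξ (B ∩ B') ≠ 0} ≤ ENNReal.ofReal (ε / 2) := by
      have hBB : MeasurableSet (B ∩ B') := hBm.inter hB'm
      have hBBf : (a • μ) (B ∩ B') < ∞ := by
        rw [hsmul]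
        exact ENNReal.mul_lt_top ENNReal.coe_lt_top
          ((measure_mono Set.inter_subset_left).trans_lt hBf)
      have hset : MeasurableSet {ξ : Measure X | ξ (B ∩ B') ≠ 0} :=
        (Measure.measurable_coe hBB) (measurableSet_singleton 0).compl
      rw [Measure.map_apply hN.measurable hset]
      -- Markov's inequality at level one: a counting measure that charges a set gives it mass at
      -- least `1`.
      have hle : P (N ⁻¹' {ξ : Measure X | ξ (B ∩ B') ≠ 0}) ≤ ∫⁻ ω, N ω (B ∩ B') ∂P := by
        rw [← lintegral_indicator_one (hN.measurable hset)]
        refine lintegral_mono fun ω => ?_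
        by_cases h0 : N ω (B ∩ B') = 0
        · simp [Set.indicator, h0]
        · obtain ⟨s, hsc, -, hs⟩ := (hN.simpleCounting ω).exists_eq_count_restrict
          have : (1 : ℝ≥0∞) ≤ N ω (B ∩ B') := by
            rw [hs, Measure.restrict_apply hBB,
              Measure.count_apply (hBB.inter hsc.measurableSet)] at h0 ⊢
            exact_mod_cast Order.one_le_iff_ne_zero.2 (by simpa using h0)
          simpa [Set.indicator, h0] using this
      refine hle.trans ?_
      rw [hN.lintegral_eq hBB hBBf, hsmul]
      calc (a : ℝ≥0∞) * μ (B ∩ B') ≤ (a + 1) * (ENNReal.ofReal (ε / 2) / (a + 1)) :=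
            mul_le_mul' le_self_add hn.le
        _ = ENNReal.ofReal (ε / 2) := ENNReal.mul_div_cancel (by simp) (by simp)
    calc _ ≤ ENNReal.ofReal (ε / 2) + ENNReal.ofReal (ε / 2) := add_le_add hEF.le hmark
      _ = ENNReal.ofReal ε := by
        rw [← ENNReal.ofReal_add (half_pos hε).le (half_pos hε).le, add_halves]
  · have hfin : ∀ {D}, μ D < ∞ → (a • μ) D < ∞ := fun h => by
      rw [hsmul]; exact ENNReal.mul_lt_top ENNReal.coe_lt_top h
    have hind := hN.indepFun_restrict hBm hC (hfin hBf)
      (hfin ((measure_mono Set.sdiff_subset).trans_lt hB'f)) disjoint_sdiff_self_right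
    have := hind.measure_inter_preimage_eq_mul _ _ hF (hτ hF)
    simp only [measureReal_def]
    rw [Measure.map_apply hN.measurable hFm, Measure.map_apply hN.measurable hGm,
      Measure.map_apply hN.measurable (hFm.inter hGm), ← ENNReal.toReal_mul]
    exact congrArg ENNReal.toReal this

/-! ### Off-diagonal parts of partition moment measures -/

theorem finpartition_eq_bot_of_part_injective {n : ℕ}
    {π : Finpartition (Finset.univ : Finset (Fin n))} (h : Function.Injective π.part) : π = ⊥ := by
  have hpart : ∀ i, π.part i = {i} := fun i => by
    ext j
    rw [Finpartition.mem_part_iff_part_eq_part _ (Finset.mem_univ _) (Finset.mem_univ _),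
      h.eq_iff, Finset.mem_singleton]
  refine Finpartition.ext ?_
  ext Q
  rw [Finpartition.mem_bot_iff]
  constructor
  · intro hQ
    obtain ⟨i, hi⟩ := exists_part_eq π ⟨Q, hQ⟩
    exact ⟨i, Finset.mem_univ i, by rw [← hpart i]; exact congrArg Subtype.val hi⟩
  · rintro ⟨i, -, rfl⟩
    rw [← hpart i]
    exact π.part_mem.2 (Finset.mem_univ i)

theorem partitionMeasure_bot {X : Type*} [MeasurableSpace X] (μ : Measure X) [SigmaFinite μ]
    (n : ℕ) : partitionMeasure μ (⊥ : Finpartition (Finset.univ : Finset (Fin n))) =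
      Measure.pi fun _ => μ := by
  refine (Measure.pi_eq fun A hA => ?_).symm
  rw [partitionMeasure_pi μ _ A hA, Finpartition.parts_bot, Finset.prod_map]
  simp

/-- If `π ≠ ⊥`, two indices share an atom and every tuple in the image of `partsEmbedding π` repeats
a point. -/
theorem partitionMeasure_injectiveTuples {X : Type*} [MeasurableSpace X] [MeasurableEq X]
    (μ : Measure X) {n : ℕ} {π : Finpartition (Finset.univ : Finset (Fin n))} (hπ : π ≠ ⊥) :
    partitionMeasure μ π (injectiveTuples (Fin n) X) = 0 := by
  have hmap := Measure.map_apply (μ := Measure.pi (fun _ : π.parts => μ))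
    (measurable_partsEmbedding π) (measurableSet_injectiveTuples (ι := Fin n) (X := X))
  have hempty : partsEmbedding π ⁻¹' injectiveTuples (Fin n) X = ∅ := by
    refine Set.eq_empty_of_forall_notMem fun y hy => hπ ?_
    refine finpartition_eq_bot_of_part_injective fun i j hij => hy ?_
    simp only [partsEmbedding, hij]
  rw [hempty, measure_empty] at hmap
  exact hmap

theorem restrict_injectiveTuples_sum_partitionMeasure {X : Type*} [MeasurableSpace X]
    [MeasurableEq X] (μ : Measure X) [SigmaFinite μ] [NullSingletonClass μ] {n : ℕ}
    (α : Finpartition (Finset.univ : Finset (Fin n)) → ℝ≥0) :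
    (∑ π, α π • partitionMeasure μ π).restrict (injectiveTuples (Fin n) X) =
      α ⊥ • Measure.pi fun _ => μ := by
  refine Measure.ext fun E hE => ?_
  rw [Measure.restrict_apply hE, Measure.finsetSum_apply, Finset.sum_eq_single ⊥]
  · rw [Measure.smul_apply, Measure.smul_apply, partitionMeasure_bot, ← Measure.restrict_apply hE,
      restrict_injectiveTuples_pi]
  · intro π _ hπ
    rw [Measure.smul_apply, measure_mono_null Set.inter_subset_right
      (partitionMeasure_injectiveTuples μ hπ), smul_zero]
  · simp

/-- The atom containing `i` contributes at most `μ (A i)`, each of the other `π.parts.card - 1` at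
most `μ B`. Linearity in `μ (A i)` is what makes the error in the ergodic average vanish. -/
theorem sum_partitionMeasure_pi_le {X : Type*} [MeasurableSpace X]
    (μ : Measure X) [SigmaFinite μ] {n : ℕ}
    (α : Finpartition (Finset.univ : Finset (Fin n)) → ℝ≥0) {A : Fin n → Set X} {B : Set X}
    (hA : ∀ i, MeasurableSet (A i)) (hAB : ∀ i, A i ⊆ B) (i : Fin n) :
    (∑ π, α π • partitionMeasure μ π) (Set.univ.pi A) ≤
      (∑ π, α π * μ B ^ (π.parts.card - 1)) * μ (A i) := by
  rw [Measure.finsetSum_apply, Finset.sum_mul]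
  refine Finset.sum_le_sum fun π _ => ?_
  rw [Measure.smul_apply, partitionMeasure_pi μ π A hA, ENNReal.smul_def, smul_eq_mul, mul_assoc]
  refine mul_le_mul' le_rfl ?_
  have hi : π.part i ∈ π.parts := π.part_mem.2 (Finset.mem_univ i)
  rw [← Finset.mul_prod_erase _ _ hi, mul_comm]
  refine mul_le_mul' ?_ (measure_mono (Set.biInter_subset_of_mem (π.mem_part (Finset.mem_univ i))))
  rw [← Finset.card_erase_of_mem hi]
  refine Finset.prod_le_pow_card _ _ _ fun Q hQ => measure_mono ?_
  obtain ⟨j, hj⟩ := π.nonempty_of_mem_parts (Finset.mem_of_mem_erase hQ)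
  exact (Set.biInter_subset_of_mem hj).trans (hAB j)

theorem memLp_two_toReal {α : Type*} [MeasurableSpace α] {m : Measure α} {f : α → ℝ≥0∞}
    (hf : Measurable f) (h : ∫⁻ x, f x ^ 2 ∂m ≠ ∞) : MemLp (fun x => (f x).toReal) 2 m := by
  rw [memLp_two_iff_integrable_sq hf.ennreal_toReal.aestronglyMeasurable]
  simp only [← ENNReal.toReal_pow]
  exact integrable_toReal_of_lintegral_ne_top (hf.pow_const 2).aemeasurable h

/-- The tuples in `C × Aⁿ` whose last `n` coordinates are pairwise distinct. -/
def headTailTuples {X : Type*} [MeasurableSpace X] (n : ℕ) (C A : Set X) : Set (Fin (n + 1) → X) :=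
  MeasurableEquiv.piFinSuccAbove (fun _ => X) 0 ⁻¹'
    (C ×ˢ (Set.univ.pi (fun _ : Fin n => A) ∩ injectiveTuples (Fin n) X))

/-- The tail being injective, a repetition must involve the head, which then equals a tail
coordinate and so lies in `A` as well as in `C`. -/
theorem headTailTuples_diff_subset {X : Type*} [MeasurableSpace X] (n : ℕ) {C A : Set X} :
    headTailTuples n C A \ injectiveTuples (Fin (n + 1)) X ⊆
      Set.univ.pi (Fin.cons (A ∩ C) fun _ : Fin n => A) := by
  rintro x ⟨⟨h0, hA, hinj⟩, hx⟩
  have h0 : x 0 ∈ C := h0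
  have hA : ∀ i : Fin n, x i.succ ∈ A := fun i => hA i trivial
  have hinj : Function.Injective fun i : Fin n => x i.succ := hinj
  have hex : ∃ i : Fin n, x 0 = x i.succ := by
    by_contra! hne
    refine hx fun i j hij => ?_
    induction i using Fin.cases with
    | zero =>
      induction j using Fin.cases with
      | zero => rfl
      | succ j => exact absurd hij (hne j)
    | succ i =>
      induction j using Fin.cases with
      | zero => exact absurd hij.symm (hne i)
      | succ j => exact congrArg Fin.succ (hinj hij)
  obtain ⟨i, hi⟩ := hex
  intro j _
  induction j using Fin.cases with
  | zero => exact ⟨hi ▸ hA i, h0⟩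
  | succ j => exact hA j

section HeadTail

variable {X : Type*} [MeasurableSpace X] [MeasurableEq X] (n : ℕ) {C A : Set X}

theorem measurableSet_headTailTuples (hC : MeasurableSet C) (hA : MeasurableSet A) :
    MeasurableSet (headTailTuples n C A) :=
  (MeasurableEquiv.measurable _)
    (hC.prod ((MeasurableSet.univ_pi fun _ => hA).inter measurableSet_injectiveTuples))

theorem pi_headTailTuples (ξ : Measure X) [SigmaFinite ξ] (hC : MeasurableSet C)
    (hA : MeasurableSet A) :
    Measure.pi (fun _ : Fin (n + 1) => ξ) (headTailTuples n C A) =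
      ξ C * Measure.pi (fun _ : Fin n => ξ)
        (Set.univ.pi (fun _ => A) ∩ injectiveTuples (Fin n) X) := by
  have h := measurePreserving_piFinSuccAbove (fun _ : Fin (n + 1) => ξ) 0
  rw [headTailTuples, h.measure_preimage (hC.prod
    ((MeasurableSet.univ_pi fun _ => hA).inter measurableSet_injectiveTuples)).nullMeasurableSet,
    Measure.prod_prod]

end HeadTail

open Classical in
/-- The restriction of `ξ` to `A` when it is finite, and `0` otherwise. -/
noncomputable def finiteRestrict {X : Type*} [MeasurableSpace X] (A : Set X) (ξ : Measure X) :
    Measure X := if ξ A < ∞ then ξ.restrict A else 0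

theorem measurable_finiteRestrict {X : Type*} [MeasurableSpace X] {A : Set X}
    (hA : MeasurableSet A) : Measurable (finiteRestrict A) :=
  Measurable.ite (measurableSet_lt (Measure.measurable_coe hA) measurable_const)
    (measurable_measure_restrict hA) measurable_const

theorem isBoundedlyFinite_finiteRestrict {X : Type*} [MetricSpace X] [MeasurableSpace X]
    (A : Set X) (ξ : Measure X) : IsBoundedlyFinite (finiteRestrict A ξ) := by
  intro B _ _
  unfold finiteRestrict
  split_ifs with h
  · exact (measure_mono (Set.subset_univ B)).trans_lt (by simpa using h)
  · simp

theorem pi_finiteRestrict {ι X : Type*} [Fintype ι] [MeasurableSpace X] {A : Set X}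
    {ξ : Measure X} [SigmaFinite ξ] (hA : MeasurableSet A) (h : ξ A < ∞) {D : Set (ι → X)}
    (hD : MeasurableSet D) :
    Measure.pi (fun _ : ι => finiteRestrict A ξ) (Set.univ.pi (fun _ => A) ∩ D) =
      Measure.pi (fun _ => ξ) (Set.univ.pi (fun _ => A) ∩ D) := by
  have hm := (MeasurableSet.univ_pi fun _ : ι => hA).inter hD
  simp only [finiteRestrict, if_pos h]
  rw [← Measure.restrict_pi_pi, Measure.restrict_apply hm,
    Set.inter_eq_left.2 Set.inter_subset_left]

/-- The coefficients of the off-diagonal parts of the moment measures of an ergodic process with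
partition moment measures are multiplicative. -/
theorem offDiagonal_coefficient_succ {X Ω : Type*} [MetricSpace X]
    [SecondCountableTopology X] [MeasurableSpace X] [BorelSpace X] [MeasurableSpace Ω]
    {μ : Measure X} [NullSingletonClass μ] (hμ : IsBoundedlyFinite μ) (hμ0 : μ ≠ 0) {T : X ≃ᵐ X}
    (hT : MeasurePreserving T μ μ)
    (hT_inv : ∀ A : Set X, MeasurableSet A → T ⁻¹' A = A → μ A = 0 ∨ μ A = ∞)
    {P : Measure Ω} [IsProbabilityMeasure P] {N : Ω → Measure X} (hN : Measurable N)
    (hb : ∀ ω, IsBoundedlyFinite (N ω)) (hmom : ∀ n, HasMoments P N n)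
    (herg : IsErgodicProcess T P N) {n : ℕ} {a c c' : ℝ≥0}
    {α : Finpartition (Finset.univ : Finset (Fin (n + 1))) → ℝ≥0}
    (h1 : (momentMeasure P N 1).restrict (injectiveTuples (Fin 1) X) = a • Measure.pi fun _ => μ)
    (hn : (momentMeasure P N n).restrict (injectiveTuples (Fin n) X) = c • Measure.pi fun _ => μ)
    (hα : momentMeasure P N (n + 1) = ∑ π, α π • partitionMeasure μ π)
    (hc' : (momentMeasure P N (n + 1)).restrict (injectiveTuples (Fin (n + 1)) X) =
      c' • Measure.pi fun _ => μ) : c' = a * c := by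
  have hsf : SigmaFinite μ := hμ.sigmaFinite
  have hNsf : ∀ ω, SigmaFinite (N ω) := fun ω => (hb ω).sigmaFinite
  have hmeas : ∀ {A : Set X}, MeasurableSet A → Measurable fun ω => N ω A := fun hA =>
    (Measure.measurable_coe hA).comp hN
  obtain ⟨A, hA, hAb, hA0⟩ : ∃ A, MeasurableSet A ∧ Bornology.IsBounded A ∧ μ A ≠ 0 := by
    have hne : Nonempty X := by
      by_contra h
      have := not_nonempty_iff.1 h
      exact hμ0 (Measure.eq_zero_of_isEmpty μ)
    obtain ⟨x⟩ := hne
    by_contra! h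
    refine hμ0 (Measure.measure_univ_eq_zero.1 ?_)
    rw [← Metric.iUnion_ball_nat x]
    exact measure_iUnion_null fun k => h _ measurableSet_ball Metric.isBounded_ball
  have hAf : μ A < ∞ := hμ A hA hAb
  have hmean : ∀ {C}, MeasurableSet C → ∫⁻ ω, N ω C ∂P = a * μ C := by
    intro C hC
    have h := congrArg (fun ρ => ρ (Set.univ.pi fun _ : Fin 1 => C)) h1
    have huniv : injectiveTuples (Fin 1) X = Set.univ :=
      Set.eq_univ_of_forall fun x => Function.injective_of_subsingleton x
    simp only [huniv, Measure.restrict_univ] at h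
    rw [momentMeasure_pi P hN hb _ (fun _ => hC), Measure.smul_apply, Measure.pi_pi] at h
    simpa using h
  set D : Set (Fin n → X) := Set.univ.pi (fun _ => A) ∩ injectiveTuples (Fin n) X with hD
  have hDm : MeasurableSet D :=
    (MeasurableSet.univ_pi fun _ => hA).inter measurableSet_injectiveTuples
  have hDμ : Measure.pi (fun _ : Fin n => μ) D = μ A ^ n := by
    rw [hD, ← Measure.restrict_apply (MeasurableSet.univ_pi fun _ => hA),
      restrict_injectiveTuples_pi, Measure.pi_pi]
    simp
  -- The law lives on the space of all measures, where product measures need not depend measurably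
  -- on `ξ`; `finiteRestrict` gives a measurable `F` that has the intended value on the boundedly
  -- finite `N ω`.
  let F : Measure X → ℝ≥0∞ := fun ξ => Measure.pi (fun _ : Fin n => finiteRestrict A ξ) D
  have hFm : Measurable F := (Measure.measurable_coe hDm).comp
    (measurable_measure_pi (measurable_finiteRestrict hA) (isBoundedlyFinite_finiteRestrict A))
  have hFN : ∀ ω, F (N ω) = Measure.pi (fun _ : Fin n => N ω) D := fun ω =>
    pi_finiteRestrict hA (hb ω A hA hAb) measurableSet_injectiveTuples
  have hFle : ∀ ω, F (N ω) ≤ N ω A ^ n := fun ω => by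
    rw [hFN]
    refine (measure_mono Set.inter_subset_left).trans_eq ?_
    simp [Measure.pi_pi]
  have hFint : ∫⁻ ω, F (N ω) ∂P = c * μ A ^ n := by
    have h := congrArg (fun ρ => ρ (Set.univ.pi fun _ : Fin n => A)) hn
    rw [Measure.restrict_apply (MeasurableSet.univ_pi fun _ => hA), momentMeasure,
      Measure.bind_apply hDm (measurable_pi_of_boundedlyFinite hN hb n).aemeasurable,
      Measure.smul_apply, Measure.pi_pi] at h
    simp only [hFN]
    rw [h]
    simp [ENNReal.smul_def]
  have hFL : MemLp (fun ξ => (F ξ).toReal) 2 (P.map N) := by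
    refine memLp_two_toReal hFm (ne_of_lt ?_)
    rw [lintegral_map (hFm.pow_const 2) hN]
    refine (lintegral_mono fun ω => pow_le_pow_left' (hFle ω) 2).trans_lt ?_
    simp only [← pow_mul]
    exact hmom (n * 2) A hA hAb
  have hgL : MemLp (fun ξ : Measure X => (ξ A).toReal) 2 (P.map N) := by
    refine memLp_two_toReal (Measure.measurable_coe hA) (ne_of_lt ?_)
    rw [lintegral_map ((Measure.measurable_coe hA).pow_const 2) hN]
    exact hmom 2 A hA hAb
  have hprob : IsProbabilityMeasure (P.map N) :=
    Measure.isProbabilityMeasure_map hN.aemeasurable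
  have hlim := tendsto_cesaro_integral_mul_of_ergodic herg hgL hFL
  have hB : ∀ k : ℕ, MeasurableSet (T^[k] ⁻¹' A) := fun k => (T.measurable.iterate k) hA
  have hμB : ∀ k : ℕ, μ (T^[k] ⁻¹' A) = μ A := fun k =>
    (hT.iterate k).measure_preimage hA.nullMeasurableSet
  have hpair : ∀ C, MeasurableSet C → ∫⁻ ω, F (N ω) * N ω C ∂P =
      momentMeasure P N (n + 1) (headTailTuples n C A) := by
    intro C hC
    rw [momentMeasure, Measure.bind_apply (measurableSet_headTailTuples n hC hA)
      (measurable_pi_of_boundedlyFinite hN hb _).aemeasurable]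
    refine lintegral_congr fun ω => ?_
    rw [pi_headTailTuples n (N ω) hC hA, hFN, mul_comm]
  -- The main term is off the diagonals, where the moment measure is `c' • μⁿ⁺¹`; the remainder is
  -- where the head meets the tail.
  have hsplit : ∀ C, MeasurableSet C → momentMeasure P N (n + 1) (headTailTuples n C A) =
      c' * (μ C * μ A ^ n) +
        momentMeasure P N (n + 1) (headTailTuples n C A \ injectiveTuples (Fin (n + 1)) X) := by
    intro C hC
    have hm := measurableSet_headTailTuples n hC hA
    rw [← measure_inter_add_sdiff _ (measurableSet_injectiveTuples (ι := Fin (n + 1)) (X := X)),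
      ← Measure.restrict_apply hm, hc', Measure.smul_apply, pi_headTailTuples n μ hC hA, hDμ]
    rfl
  set K : ℝ≥0∞ := ∑ π, α π * μ A ^ (π.parts.card - 1) with hK
  have hKf : K ≠ ∞ := by
    refine (ENNReal.sum_lt_top.2 fun π _ => ?_).ne
    exact ENNReal.mul_lt_top ENNReal.coe_lt_top (ENNReal.pow_lt_top hAf)
  have herr : ∀ C, MeasurableSet C →
      momentMeasure P N (n + 1) (headTailTuples n C A \ injectiveTuples (Fin (n + 1)) X) ≤
        K * μ (A ∩ C) := by
    intro C hC
    refine (measure_mono (headTailTuples_diff_subset n)).trans ?_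
    rw [hα]
    refine sum_partitionMeasure_pi_le μ α (fun i => ?_) (fun i => ?_) 0
    · induction i using Fin.cases with
      | zero => exact hA.inter hC
      | succ i => exact hA
    · induction i using Fin.cases with
      | zero => exact Set.inter_subset_left
      | succ i => exact subset_rfl
  have hint : ∀ k : ℕ, ∫ ξ, (F ξ).toReal * ((fun ξ : Measure X => ξ.map T)^[k] ξ A).toReal ∂(P.map N)
      = c' * (μ.real A) ^ (n + 1) + (momentMeasure P N (n + 1)
        (headTailTuples n (T^[k] ⁻¹' A) A \ injectiveTuples (Fin (n + 1)) X)).toReal := by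
    intro k
    have hgk : ∀ ξ : Measure X, (fun ξ : Measure X => ξ.map T)^[k] ξ A = ξ (T^[k] ⁻¹' A) :=
      fun ξ => by
        rw [iterate_measure_map T.measurable, Measure.map_apply (T.measurable.iterate k) hA]
    simp only [hgk, ← ENNReal.toReal_mul]
    have hmk : Measurable fun ξ : Measure X => F ξ * ξ (T^[k] ⁻¹' A) :=
      hFm.mul (Measure.measurable_coe (hB k))
    have hfin : momentMeasure P N (n + 1)
        (headTailTuples n (T^[k] ⁻¹' A) A \ injectiveTuples (Fin (n + 1)) X) ≠ ∞ :=
      ne_top_of_le_ne_top (ENNReal.mul_ne_top hKf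
        (ne_top_of_le_ne_top hAf.ne (measure_mono Set.inter_subset_left))) (herr _ (hB k))
    have hfin' : (c' : ℝ≥0∞) * (μ (T^[k] ⁻¹' A) * μ A ^ n) ≠ ∞ := by
      rw [hμB]
      exact ENNReal.mul_ne_top ENNReal.coe_ne_top
        (ENNReal.mul_ne_top hAf.ne (ENNReal.pow_ne_top hAf.ne))
    have hl : ∫⁻ ξ, F ξ * ξ (T^[k] ⁻¹' A) ∂(P.map N) = c' * (μ (T^[k] ⁻¹' A) * μ A ^ n) +
        momentMeasure P N (n + 1)
          (headTailTuples n (T^[k] ⁻¹' A) A \ injectiveTuples (Fin (n + 1)) X) := by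
      rw [lintegral_map hmk hN, hpair _ (hB k), hsplit _ (hB k)]
    rw [integral_toReal hmk.aemeasurable (ae_lt_top hmk (by
      rw [hl]; exact ENNReal.add_ne_top.2 ⟨hfin', hfin⟩)), hl, ENNReal.toReal_add hfin' hfin, hμB,
      ENNReal.toReal_mul, ← pow_succ', ENNReal.toReal_pow]
    rfl
  -- The remainders are at most `K μ (A ∩ T⁻ᵏ A)`, whose averages tend to `0`. Comparison with the
  -- ergodic limit `hlim` then gives the recursion, as `μ A` is neither `0` nor `∞`.
  have hlim2 : Tendsto (fun L : ℕ => (L : ℝ)⁻¹ * ∑ k ∈ Finset.range L,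
      ∫ ξ, (F ξ).toReal * ((fun ξ : Measure X => ξ.map T)^[k] ξ A).toReal ∂(P.map N)) atTop
      (𝓝 (c' * (μ.real A) ^ (n + 1))) := by
    have h0 := (tendsto_cesaro_measureReal_inter hT hT_inv hA hA hAf.ne hAf.ne).const_mul K.toReal
    rw [mul_zero] at h0
    have hz : Tendsto (fun L : ℕ => (L : ℝ)⁻¹ * ∑ k ∈ Finset.range L, (momentMeasure P N (n + 1)
        (headTailTuples n (T^[k] ⁻¹' A) A \ injectiveTuples (Fin (n + 1)) X)).toReal) atTop
        (𝓝 0) := by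
      refine squeeze_zero (fun L => mul_nonneg (by positivity)
        (Finset.sum_nonneg fun k _ => ENNReal.toReal_nonneg)) (fun L => ?_) h0
      rw [mul_left_comm, Finset.mul_sum _ _ K.toReal]
      refine mul_le_mul_of_nonneg_left (Finset.sum_le_sum fun k _ => ?_)
        (inv_nonneg.2 (Nat.cast_nonneg L))
      rw [measureReal_def, ← ENNReal.toReal_mul]
      exact ENNReal.toReal_mono (ENNReal.mul_ne_top hKf
        (ne_top_of_le_ne_top hAf.ne (measure_mono Set.inter_subset_left))) (herr _ (hB k))
    have hs := Tendsto.const_add ((c' : ℝ) * (μ.real A) ^ (n + 1)) hz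
    rw [add_zero] at hs
    refine hs.congr' ?_
    filter_upwards [eventually_gt_atTop 0] with L hL
    have hL' : (L : ℝ) ≠ 0 := by positivity
    simp only [hint, Finset.sum_add_distrib, Finset.sum_const, Finset.card_range, nsmul_eq_mul]
    field_simp
  have heq := tendsto_nhds_unique hlim2 hlim
  have hI1 : ∫ ξ, (F ξ).toReal ∂(P.map N) = c * μ.real A ^ n := by
    have hl : ∫⁻ ξ, F ξ ∂(P.map N) = c * μ A ^ n := by rw [lintegral_map hFm hN, hFint]
    rw [integral_toReal hFm.aemeasurable (ae_lt_top hFm (by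
      rw [hl]; exact ENNReal.mul_ne_top ENNReal.coe_ne_top (ENNReal.pow_ne_top hAf.ne))), hl,
      ENNReal.toReal_mul, ENNReal.toReal_pow]
    rfl
  have hI2 : ∫ ξ, (ξ A).toReal ∂(P.map N) = a * μ.real A := by
    have hl : ∫⁻ ξ, ξ A ∂(P.map N) = a * μ A := by
      rw [lintegral_map (Measure.measurable_coe hA) hN, hmean hA]
    rw [integral_toReal (Measure.measurable_coe hA).aemeasurable
      (ae_lt_top (Measure.measurable_coe hA) (by
      rw [hl]; exact ENNReal.mul_ne_top ENNReal.coe_ne_top hAf.ne)), hl, ENNReal.toReal_mul]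
    rfl
  rw [hI1, hI2] at heq
  have hpos : μ.real A ≠ 0 := ENNReal.toReal_ne_zero.2 ⟨hA0, hAf.ne⟩
  have hfinal : (c' : ℝ) = a * c := by
    have hp : μ.real A ^ (n + 1) ≠ 0 := pow_ne_zero _ hpos
    apply mul_right_cancel₀ hp
    rw [heq]; ring
  exact_mod_cast hfinal

theorem exists_restrict_momentMeasure_eq_pi {X Ω : Type*} [MetricSpace X]
    [SecondCountableTopology X] [MeasurableSpace X] [BorelSpace X] [MeasurableSpace Ω]
    {μ : Measure X} [NullSingletonClass μ] (hμ : IsBoundedlyFinite μ) (hμ0 : μ ≠ 0) {T : X ≃ᵐ X}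
    (hT : MeasurePreserving T μ μ)
    (hT_inv : ∀ A : Set X, MeasurableSet A → T ⁻¹' A = A → μ A = 0 ∨ μ A = ∞)
    {P : Measure Ω} [IsProbabilityMeasure P] {N : Ω → Measure X} (hN : Measurable N)
    (hb : ∀ ω, IsBoundedlyFinite (N ω)) (hmom : ∀ n, HasMoments P N n)
    (herg : IsErgodicProcess T P N)
    (hM : ∀ n : ℕ, 1 ≤ n → ∃ α : Finpartition (Finset.univ : Finset (Fin n)) → ℝ≥0,
      momentMeasure P N n = ∑ π, α π • partitionMeasure μ π) :
    ∃ a : ℝ≥0, ∀ n : ℕ, (momentMeasure P N n).restrict (injectiveTuples (Fin n) X) =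
      Measure.pi fun _ => a • μ := by
  have hsf : SigmaFinite μ := hμ.sigmaFinite
  obtain ⟨α₁, hα₁⟩ := hM 1 le_rfl
  have h1 := hα₁ ▸ restrict_injectiveTuples_sum_partitionMeasure μ α₁
  refine ⟨α₁ ⊥, fun n => ?_⟩
  rw [pi_nnreal_smul, Fintype.card_fin]
  induction n with
  -- In order `0` both measures have total mass one on a single point, because `P` is a probability
  -- measure.
  | zero =>
    rw [pow_zero, one_smul, ← restrict_injectiveTuples_pi μ]
    refine restrict_injectiveTuples_congr fun A hA _ _ => ?_
    rw [momentMeasure_pi P hN hb A hA, Measure.pi_pi]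
    simp
  | succ n ih =>
    obtain ⟨α, hα⟩ := hM (n + 1) (by omega)
    have hc' := hα ▸ restrict_injectiveTuples_sum_partitionMeasure μ α
    rw [hc', offDiagonal_coefficient_succ hμ hμ0 hT hT_inv hN hb hmom herg h1 ih hα hc', pow_succ']

/-! ### Recovering the Poisson law from factorial moments -/

open Classical in
-- Each `n`-element subset of `t` is the range of exactly `n!` injective tuples, all with the same
-- product.
theorem sum_injective_prod_eq_factorial_mul {X : Type*} (t : Finset X) (f : X → ℂ) (n : ℕ) :
    ∑ y ∈ (Fintype.piFinset fun _ : Fin n => t) with Function.Injective y, ∏ i, f (y i) =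
      n.factorial * ∑ u ∈ t.powersetCard n, ∏ x ∈ u, f x := by
  have hmaps : ∀ y ∈ (Fintype.piFinset fun _ : Fin n => t).filter Function.Injective,
      Finset.univ.image y ∈ t.powersetCard n := by
    intro y hy
    simp only [Finset.mem_filter, Fintype.mem_piFinset] at hy
    rw [Finset.mem_powersetCard]
    refine ⟨fun x hx => ?_, by rw [Finset.card_image_of_injective _ hy.2]; simp⟩
    obtain ⟨i, -, rfl⟩ := Finset.mem_image.1 hx
    exact hy.1 i
  rw [← Finset.sum_fiberwise_of_maps_to hmaps, Finset.mul_sum]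
  refine Finset.sum_congr rfl fun u hu => ?_
  obtain ⟨hut, hcard⟩ := Finset.mem_powersetCard.1 hu
  have hterm : ∀ y ∈ ((Fintype.piFinset fun _ : Fin n => t).filter Function.Injective).filter
      (fun y => Finset.univ.image y = u), ∏ i, f (y i) = ∏ x ∈ u, f x := by
    intro y hy
    simp only [Finset.mem_filter] at hy
    rw [← hy.2, Finset.prod_image fun a _ b _ h => hy.1.2 h]
  rw [Finset.sum_congr rfl hterm, Finset.sum_const, nsmul_eq_mul]
  congr 2
  have hemb : Fintype.card (Fin n ↪ u) = n.factorial := by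
    rw [Fintype.card_embedding_eq, Fintype.card_coe, Fintype.card_fin, hcard,
      Nat.descFactorial_self]
  rw [← hemb, ← Finset.card_univ]
  symm
  refine Finset.card_bij (fun g _ i => (g i : X)) ?_ ?_ ?_
  · intro g _
    have hinj : Function.Injective fun i => (g i : X) := Subtype.val_injective.comp g.injective
    simp only [Finset.mem_filter, Fintype.mem_piFinset]
    refine ⟨⟨fun i => hut (g i).2, hinj⟩, ?_⟩
    refine Finset.eq_of_subset_of_card_le (fun x hx => ?_) ?_
    · obtain ⟨i, -, rfl⟩ := Finset.mem_image.1 hx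
      exact (g i).2
    · rw [Finset.card_image_of_injective _ hinj, hcard]; simp
  · intro g _ g' _ h
    ext i
    exact congrFun h i
  · intro y hy
    simp only [Finset.mem_filter, Fintype.mem_piFinset] at hy
    have hmem : ∀ i, y i ∈ u := fun i => by
      rw [← hy.2]; exact Finset.mem_image_of_mem _ (Finset.mem_univ i)
    exact ⟨⟨fun i => ⟨y i, hmem i⟩, fun i j h => hy.1.2 (congrArg Subtype.val h)⟩,
      Finset.mem_univ _, rfl⟩

-- With `f = z j` on `A j`, the right side is `∏ (1 + f x)` over the finitely many points of `ξ` in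
-- the `A j`. Expanding over subsets grouped by cardinality gives the factorial powers of `ξ`; the
-- terms vanish once `n` exceeds the number of points.
open Classical in
theorem IsSimpleCounting.hasSum_prod_one_add_pow {X J : Type*} [Fintype J] [MetricSpace X]
    [SecondCountableTopology X] [MeasurableSpace X] [BorelSpace X] {ξ : Measure X}
    (hξ : IsSimpleCounting ξ) {A : J → Set X} (hA : ∀ j, MeasurableSet (A j))
    (hf : ∀ j, ξ (A j) < ∞) (hd : Pairwise fun i j => Disjoint (A i) (A j)) :
    ∃ m : J → ℕ, (∀ j, ξ (A j) = m j) ∧ ∀ z : J → ℂ,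
      HasSum (fun n : ℕ => (n.factorial : ℂ)⁻¹ * ∑ p : Fin n → J, (∏ i, z (p i)) *
        ((Measure.pi (fun _ : Fin n => ξ)
          (Set.univ.pi (fun i => A (p i)) ∩ injectiveTuples (Fin n) X)).toReal : ℂ))
        (∏ j, (1 + z j) ^ m j) := by
  obtain ⟨s, hs, hξs, hpi⟩ := hξ.exists_pi_apply_eq_count
  have hfin : ∀ j, (A j ∩ s).Finite := fun j => by
    have h := hf j
    rw [hξs, Measure.restrict_apply (hA j)] at h
    exact Measure.count_apply_lt_top.1 h
  let t : J → Finset X := fun j => (hfin j).toFinset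
  have ht : ∀ {j x}, x ∈ t j ↔ x ∈ A j ∧ x ∈ s := fun {j x} => by simp [t]
  have htd : ∀ {i j x}, x ∈ A i → x ∈ A j → i = j := fun {i j x} hi hj => by
    by_contra h
    exact Set.disjoint_left.1 (hd h) hi hj
  refine ⟨fun j => (t j).card, fun j => ?_, fun z => ?_⟩
  · rw [hξs, Measure.restrict_apply (hA j), Measure.count_apply_finite _ (hfin j)]
  let f : X → ℂ := fun x => ∑ j, if x ∈ A j then z j else 0
  have hfA : ∀ {x j}, x ∈ A j → f x = z j := fun {x j} hx => by
    simp only [f]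
    rw [Finset.sum_eq_single j (fun i _ hij => if_neg fun hi => hij (htd hi hx)) (by simp),
      if_pos hx]
  let u : Finset X := Finset.univ.biUnion t
  have hu : ∀ {x}, x ∈ u ↔ ∃ j, x ∈ t j := fun {x} => by simp [u]
  have hprod : ∏ j, (1 + z j) ^ (t j).card = ∏ x ∈ u, (1 + f x) := by
    rw [Finset.prod_biUnion]
    · refine Finset.prod_congr rfl fun j _ => ?_
      rw [Finset.prod_congr rfl (fun x hx => by rw [hfA (ht.1 hx).1]), Finset.prod_const]
    · intro i _ j _ hij
      exact Finset.disjoint_left.2 fun x hi hj => hij (htd (ht.1 hi).1 (ht.1 hj).1)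
  have hterm : ∀ n : ℕ, ∑ p : Fin n → J, (∏ i, z (p i)) *
      ((Measure.pi (fun _ : Fin n => ξ)
        (Set.univ.pi (fun i => A (p i)) ∩ injectiveTuples (Fin n) X)).toReal : ℂ) =
      n.factorial * ∑ v ∈ u.powersetCard n, ∏ x ∈ v, f x := by
    intro n
    rw [← sum_injective_prod_eq_factorial_mul]
    have hexp : ∀ y : Fin n → X, ∏ i, f (y i) =
        ∑ p : Fin n → J, if ∀ i, y i ∈ A (p i) then ∏ i, z (p i) else 0 := by
      intro y
      simp only [f]
      rw [Finset.prod_univ_sum, Fintype.piFinset_univ]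
      refine Finset.sum_congr rfl fun p _ => ?_
      split_ifs with h
      · exact Finset.prod_congr rfl fun i _ => if_pos (h i)
      · obtain ⟨i, hi⟩ := not_forall.1 h
        exact Finset.prod_eq_zero (Finset.mem_univ i) (if_neg hi)
    simp only [hexp]
    rw [Finset.sum_comm]
    refine Finset.sum_congr rfl fun p _ => ?_
    rw [← Finset.sum_filter, Finset.sum_const, nsmul_eq_mul, mul_comm]
    congr 1
    have hm : MeasurableSet (Set.univ.pi (fun i => A (p i)) ∩ injectiveTuples (Fin n) X) :=
      (MeasurableSet.univ_pi fun i => hA _).inter measurableSet_injectiveTuples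
    rw [hpi _ _ hm]
    have hset : Set.univ.pi (fun i => A (p i)) ∩ injectiveTuples (Fin n) X ∩
        Set.univ.pi (fun _ => s) =
        ((((Fintype.piFinset fun _ : Fin n => u).filter Function.Injective).filter
          (fun y => ∀ i, y i ∈ A (p i)) : Finset (Fin n → X)) : Set (Fin n → X)) := by
      ext y
      simp only [Set.mem_inter_iff, Set.mem_univ_pi, Finset.coe_filter, Finset.mem_filter,
        Fintype.mem_piFinset, hu, ht, Set.mem_ofPred_eq, injectiveTuples]
      constructor
      · rintro ⟨⟨h1, h2⟩, h3⟩
        exact ⟨⟨fun i => ⟨p i, h1 i, h3 i⟩, h2⟩, h1⟩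
      · rintro ⟨⟨h1, h2⟩, h3⟩
        exact ⟨⟨h3, h2⟩, fun i => (h1 i).choose_spec.2⟩
    rw [hset, Measure.count_apply_finset]
    simp
  have hterm' : ∀ n : ℕ, (n.factorial : ℂ)⁻¹ * ∑ p : Fin n → J, (∏ i, z (p i)) *
      ((Measure.pi (fun _ : Fin n => ξ)
        (Set.univ.pi (fun i => A (p i)) ∩ injectiveTuples (Fin n) X)).toReal : ℂ) =
      ∑ v ∈ u.powersetCard n, ∏ x ∈ v, f x := fun n => by
    rw [hterm n, inv_mul_cancel_left₀ (Nat.cast_ne_zero.2 n.factorial_ne_zero)]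
  simp only [hterm']
  rw [hprod, Finset.prod_one_add, Finset.sum_powerset]
  refine hasSum_sum_of_ne_finset_zero fun n hn => ?_
  rw [Finset.powersetCard_eq_empty.2 (by simpa using hn), Finset.sum_empty]

theorem lintegral_eq_of_restrict_momentMeasure {X Ω : Type*} [MetricSpace X]
    [MeasurableSpace X] [BorelSpace X] [MeasurableSpace Ω] {ν : Measure X} [SigmaFinite ν]
    {P : Measure Ω} {N : Ω → Measure X} (hN : Measurable N)
    (hb : ∀ ω, IsBoundedlyFinite (N ω))
    (hM : (momentMeasure P N 1).restrict (injectiveTuples (Fin 1) X) = Measure.pi fun _ => ν)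
    {C : Set X} (hC : MeasurableSet C) : ∫⁻ ω, N ω C ∂P = ν C := by
  have h := congrArg (fun ρ => ρ (Set.univ.pi fun _ : Fin 1 => C)) hM
  have huniv : injectiveTuples (Fin 1) X = Set.univ :=
    Set.eq_univ_of_forall fun x => Function.injective_of_subsingleton x
  simp only [huniv, Measure.restrict_univ] at h
  rw [momentMeasure_pi P hN hb _ (fun _ => hC), Measure.pi_pi] at h
  simpa using h

section OffDiagonal

variable {X Ω : Type*} [MetricSpace X] [SecondCountableTopology X] [MeasurableSpace X]
  [BorelSpace X] [MeasurableSpace Ω] {ν : Measure X} {P : Measure Ω}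
  {N : Ω → Measure X}

/-- Put `z j = exp (i θ j) - 1` in the factorial expansion and integrate termwise. The `n`-th term
has mean `(∑ z j ν(A j))ⁿ / n!` and `L¹` norm at most the same with `‖z j‖`, so the exchange is
legitimate and the sum is an exponential. -/
theorem integral_exp_eq_of_restrict_momentMeasure [SigmaFinite ν] (hN : Measurable N)
    (hs : ∀ ω, IsSimpleCounting (N ω))
    (hM : ∀ n, (momentMeasure P N n).restrict (injectiveTuples (Fin n) X) = Measure.pi fun _ => ν)
    {J : Type*} [Fintype J] {A : J → Set X} (hA : ∀ j, MeasurableSet (A j))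
    (hf : ∀ j, ν (A j) < ∞) (hd : Pairwise fun i j => Disjoint (A i) (A j)) (θ : J → ℝ) :
    ∫ ω, Complex.exp ((∑ j, θ j * (N ω (A j)).toReal : ℝ) * Complex.I) ∂P =
      ∏ j, Complex.exp ((ν (A j)).toReal * (Complex.exp (θ j * Complex.I) - 1)) := by
  classical
  have hb := fun ω => (hs ω).isBoundedlyFinite
  let z : J → ℂ := fun j => Complex.exp (θ j * Complex.I) - 1
  let E : ∀ n : ℕ, (Fin n → J) → Set (Fin n → X) := fun n p =>
    Set.univ.pi (fun i => A (p i)) ∩ injectiveTuples (Fin n) X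
  have hE : ∀ n p, MeasurableSet (E n p) := fun n p =>
    (MeasurableSet.univ_pi fun i => hA _).inter measurableSet_injectiveTuples
  let Y : ∀ n : ℕ, (Fin n → J) → Ω → ℝ := fun n p ω =>
    (Measure.pi (fun _ : Fin n => N ω) (E n p)).toReal
  have hYm : ∀ n p, Measurable fun ω => Measure.pi (fun _ : Fin n => N ω) (E n p) := fun n p =>
    (Measure.measurable_coe (hE n p)).comp (measurable_pi_of_boundedlyFinite hN hb n)
  have hYl : ∀ n p, ∫⁻ ω, Measure.pi (fun _ : Fin n => N ω) (E n p) ∂P = ∏ i, ν (A (p i)) := by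
    intro n p
    have h := congrArg (fun ρ => ρ (Set.univ.pi fun i : Fin n => A (p i))) (hM n)
    rw [Measure.restrict_apply (MeasurableSet.univ_pi fun i => hA _), momentMeasure,
      Measure.bind_apply (hE n p) (measurable_pi_of_boundedlyFinite hN hb n).aemeasurable,
      Measure.pi_pi] at h
    exact h
  have hYf : ∀ n p, ∫⁻ ω, Measure.pi (fun _ : Fin n => N ω) (E n p) ∂P ≠ ∞ := fun n p => by
    rw [hYl]; exact (ENNReal.prod_lt_top fun i _ => hf _).ne
  have hYi : ∀ n p, Integrable (Y n p) P := fun n p =>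
    integrable_toReal_of_lintegral_ne_top (hYm n p).aemeasurable (hYf n p)
  have hYint : ∀ n p, ∫ ω, Y n p ω ∂P = ∏ i, (ν (A (p i))).toReal := fun n p => by
    rw [integral_toReal (hYm n p).aemeasurable (ae_lt_top (hYm n p) (hYf n p)), hYl,
      ENNReal.toReal_prod]
  let F : ℕ → Ω → ℂ := fun n ω => (n.factorial : ℂ)⁻¹ * ∑ p : Fin n → J, (∏ i, z (p i)) * (Y n p ω : ℂ)
  have hFi : ∀ n, Integrable (F n) P := fun n =>
    (integrable_finsetSum _ fun p _ => (hYi n p).ofReal.const_mul _).const_mul _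
  have hFint : ∀ n, ∫ ω, F n ω ∂P =
      (n.factorial : ℂ)⁻¹ * (∑ j, z j * (ν (A j)).toReal) ^ n := by
    intro n
    simp only [F]
    rw [integral_const_mul, integral_finsetSum _ fun p _ => (hYi n p).ofReal.const_mul _,
      Fintype.sum_pow]
    congr 1
    refine Finset.sum_congr rfl fun p _ => ?_
    rw [integral_const_mul, show ∫ ω, (Y n p ω : ℂ) ∂P = ((∫ ω, Y n p ω ∂P : ℝ) : ℂ) from
      integral_ofReal, hYint, Finset.prod_mul_distrib]
    push_cast
    rfl
  have hFnorm : ∀ n, ∫ ω, ‖F n ω‖ ∂P ≤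
      (n.factorial : ℝ)⁻¹ * (∑ j, ‖z j‖ * (ν (A j)).toReal) ^ n := by
    intro n
    have hle : ∀ ω, ‖F n ω‖ ≤ (n.factorial : ℝ)⁻¹ * ∑ p : Fin n → J, (∏ i, ‖z (p i)‖) * Y n p ω := by
      intro ω
      simp only [F, norm_mul, norm_inv, Complex.norm_natCast]
      refine mul_le_mul_of_nonneg_left ((norm_sum_le _ _).trans_eq ?_) (by positivity)
      refine Finset.sum_congr rfl fun p _ => ?_
      rw [norm_mul, norm_prod, Complex.norm_real, Real.norm_of_nonneg ENNReal.toReal_nonneg]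
    have hi : Integrable (fun ω => (n.factorial : ℝ)⁻¹ *
        ∑ p : Fin n → J, (∏ i, ‖z (p i)‖) * Y n p ω) P :=
      (integrable_finsetSum _ fun p _ => (hYi n p).const_mul _).const_mul _
    refine (integral_mono (hFi n).norm hi hle).trans_eq ?_
    rw [integral_const_mul, integral_finsetSum _ fun p _ => (hYi n p).const_mul _,
      Fintype.sum_pow]
    congr 1
    refine Finset.sum_congr rfl fun p _ => ?_
    rw [integral_const_mul, hYint, Finset.prod_mul_distrib]
  have hsummable : Summable fun n => ∫ ω, ‖F n ω‖ ∂P := by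
    refine Summable.of_nonneg_of_le (fun n => integral_nonneg fun ω => norm_nonneg _) hFnorm ?_
    refine (Real.summable_pow_div_factorial (∑ j, ‖z j‖ * (ν (A j)).toReal)).congr fun n => ?_
    rw [div_eq_inv_mul]
  have hsum := hasSum_integral_of_summable_integral_norm hFi hsummable
  have hexp : HasSum (fun n => ∫ ω, F n ω ∂P) (Complex.exp (∑ j, z j * (ν (A j)).toReal)) := by
    have h := NormedSpace.expSeries_div_hasSum_exp (∑ j, z j * ((ν (A j)).toReal : ℂ))
    rw [← Complex.exp_eq_exp_ℂ] at h
    refine h.congr_fun fun n => ?_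
    rw [hFint, div_eq_inv_mul]
  have hlim := hsum.unique hexp
  have hae : ∀ᵐ ω ∂P, Complex.exp ((∑ j, θ j * (N ω (A j)).toReal : ℝ) * Complex.I) =
      ∑' n, F n ω := by
    have hfin : ∀ᵐ ω ∂P, ∀ j, N ω (A j) < ∞ := eventually_all.2 fun j =>
      ae_lt_top ((Measure.measurable_coe (hA j)).comp hN) (by
        rw [lintegral_eq_of_restrict_momentMeasure hN hb (hM 1) (hA j)]; exact (hf j).ne)
    filter_upwards [hfin] with ω hω
    obtain ⟨m, hm, hs⟩ := (hs ω).hasSum_prod_one_add_pow hA hω hd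
    rw [(hs z).tsum_eq]
    simp only [hm, z, ENNReal.toReal_natCast, add_sub_cancel, ← Complex.exp_nat_mul]
    rw [← Complex.exp_sum]
    congr 1
    push_cast
    rw [Finset.sum_mul]
    exact Finset.sum_congr rfl fun j _ => by ring
  rw [integral_congr_ae hae, hlim, Complex.exp_sum]
  exact Finset.prod_congr rfl fun j _ => by rw [mul_comm]

theorem map_toReal_eq_poisson [IsProbabilityMeasure P] [SigmaFinite ν] (hN : Measurable N)
    (hs : ∀ ω, IsSimpleCounting (N ω))
    (hM : ∀ n, (momentMeasure P N n).restrict (injectiveTuples (Fin n) X) = Measure.pi fun _ => ν)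
    {A : Set X} (hA : MeasurableSet A) (hf : ν A < ∞) :
    P.map (fun ω => (N ω A).toReal) = (poissonMeasure (ν A).toNNReal).map (fun j : ℕ => (j : ℝ)) := by
  have hm : Measurable fun ω => (N ω A).toReal :=
    ((Measure.measurable_coe hA).comp hN).ennreal_toReal
  have hp : IsProbabilityMeasure (P.map fun ω => (N ω A).toReal) :=
    Measure.isProbabilityMeasure_map hm.aemeasurable
  have hp' : IsProbabilityMeasure ((poissonMeasure (ν A).toNNReal).map (fun j : ℕ => (j : ℝ))) :=
    Measure.isProbabilityMeasure_map (by fun_prop)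
  refine Measure.ext_of_charFun (funext fun t => ?_)
  rw [charFun_map_cast_poissonMeasure, charFun_apply_real, integral_map hm.aemeasurable (by fun_prop)]
  have h := integral_exp_eq_of_restrict_momentMeasure hN hs hM (J := Unit) (A := fun _ => A)
    (fun _ => hA) (fun _ => hf) (fun i j hij => absurd (Subsingleton.elim i j) hij) (fun _ => t)
  simp only [Finset.univ_unique, Finset.sum_singleton, Finset.prod_singleton] at h
  push_cast at h
  exact h

theorem isPoissonProcess_of_restrict_momentMeasure [IsProbabilityMeasure P]
    [SigmaFinite ν] (hN : Measurable N)
    (hs : ∀ ω, IsSimpleCounting (N ω))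
    (hM : ∀ n, (momentMeasure P N n).restrict (injectiveTuples (Fin n) X) = Measure.pi fun _ => ν) :
    IsPoissonProcess ν P N := by
  have hb := fun ω => (hs ω).isBoundedlyFinite
  have hm : ∀ {A}, MeasurableSet A → Measurable fun ω => N ω A := fun hA =>
    (Measure.measurable_coe hA).comp hN
  -- `A` may be unbounded, so `N ω A` may be infinite; it has finite mean, hence is almost surely
  -- finite, and real characteristic functions decide independence and law.
  have hreal : ∀ {A}, MeasurableSet A → ν A < ∞ →
      (fun ω => ENNReal.ofReal (N ω A).toReal) =ᵐ[P] fun ω => N ω A := by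
    intro A hA hf
    filter_upwards [ae_lt_top (hm hA) (by
      rw [lintegral_eq_of_restrict_momentMeasure hN hb (hM 1) hA]; exact hf.ne)] with ω hω
    exact ENNReal.ofReal_toReal hω.ne
  refine ⟨hN, hs, fun k A hA hf hd => ?_, fun A hA hf => ?_⟩
  · have hmr : ∀ i, Measurable fun ω => (N ω (A i)).toReal := fun i => (hm (hA i)).ennreal_toReal
    have hmv : Measurable fun ω => WithLp.toLp 2 fun i => (N ω (A i)).toReal :=
      (WithLp.measurable_toLp 2 _).comp (measurable_pi_lambda _ hmr)
    have hind : iIndepFun (fun i ω => (N ω (A i)).toReal) P := by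
      rw [iIndepFun_iff_charFun_pi fun i => (hmr i).aemeasurable]
      intro t
      rw [charFun_apply, integral_map hmv.aemeasurable (by fun_prop)]
      have h := integral_exp_eq_of_restrict_momentMeasure hN hs hM hA hf hd (fun i => t i)
      have hinner : ∀ ω, inner ℝ (WithLp.toLp 2 fun i => (N ω (A i)).toReal) t =
          ∑ j, t j * (N ω (A j)).toReal := fun ω => by
        rw [PiLp.inner_apply]; rfl
      simp only [hinner]
      rw [h]
      refine Finset.prod_congr rfl fun i _ => ?_
      rw [map_toReal_eq_poisson hN hs hM (hA i) (hf i), charFun_map_cast_poissonMeasure]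
      rfl
    exact (hind.comp (fun _ => ENNReal.ofReal) fun _ => ENNReal.measurable_ofReal).congr
      fun i => hreal (hA i) (hf i)
  · have hmap := congrArg (fun ρ => ρ.map ENNReal.ofReal) (map_toReal_eq_poisson hN hs hM hA hf)
    rw [Measure.map_map ENNReal.measurable_ofReal (hm hA).ennreal_toReal,
      Measure.map_map ENNReal.measurable_ofReal .of_discrete] at hmap
    rw [← Measure.map_congr (hreal hA hf)]
    refine hmap.trans ?_
    congr 1
    funext j
    simp

end OffDiagonal

end TPoint

/-! ### The characterisation -/

theorem mainTheorem6 {X Ω : Type*} [MetricSpace X] [CompleteSpace X]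
    [TopologicalSpace.SeparableSpace X] [MeasurableSpace X] [BorelSpace X] [MeasurableSpace Ω]
    (μ : Measure X) [NullSingletonClass μ] (hμ_bdd : TPoint.IsBoundedlyFinite μ) (hμ_inf : μ Set.univ = ∞)
    (T : X ≃ᵐ X) (hT : MeasurePreserving T μ μ)
    (hT_inv : ∀ A : Set X, MeasurableSet A → T ⁻¹' A = A → μ A = 0 ∨ μ A = ∞)
    (P : Measure Ω) [IsProbabilityMeasure P] (S : Ω ≃ᵐ Ω) (N : Ω → Measure X)
    (hN : TPoint.IsTPointProcess μ T P S N) (hN_mom : ∀ n : ℕ, TPoint.HasMoments P N n) :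
    (∃ a : ℝ≥0, TPoint.IsPoissonProcess (a • μ) P N) ↔
      TPoint.IsErgodicProcess T P N ∧
        ∀ n : ℕ, 1 ≤ n → ∃ α : Finpartition (Finset.univ : Finset (Fin n)) → ℝ≥0,
          TPoint.momentMeasure P N n = ∑ π, α π • TPoint.partitionMeasure μ π := by
  have hsc : SecondCountableTopology X := UniformSpace.secondCountable_of_separable X
  have hsf : SigmaFinite μ := hμ_bdd.sigmaFinite
  constructor
  · rintro ⟨a, ha⟩
    exact ⟨ha.isErgodicProcess hμ_bdd hT hT_inv hN.toIsTRandomMeasure.measurePreserving_map,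
      fun n _ => ⟨_, ha.momentMeasure_eq hμ_bdd n⟩⟩
  · rintro ⟨herg, hM⟩
    have hμ0 : μ ≠ 0 := by rintro rfl; simp at hμ_inf
    obtain ⟨a, ha⟩ := TPoint.exists_restrict_momentMeasure_eq_pi hμ_bdd hμ0 hT hT_inv
      hN.measurable hN.boundedlyFinite hN_mom herg hM
    exact ⟨a, TPoint.isPoissonProcess_of_restrict_momentMeasure hN.measurable
      hN.simpleCounting ha⟩
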